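/- Let $0<q<1$, $0<\mu<1$ and $\beta>-1$. Write $(a;q)_k=\prod_{i=0}^{k-1}(1-aq^i)$ for $k\in\mathbb N_0$, $(a;q)_\infty=\prod_{i\ge 0}(1-aq^i)$, $(a;q)_\nu=(a;q)_\infty/(aq^\nu;q)_\infty$ for real $\nu$, and $\Gamma_q(z)=\frac{(q;q)_\infty}{(q^z;q)_\infty}(1-q)^{1-z}$. Let $A_q=\{q^m:m\in\mathbb N_0\}$ and $A_q^*=A_q\cup\{0\}$. The Jackson integral is $\int_0^b f(t)\,d_qt=(1-q)\sum_{j\ge 0}bq^jf(bq^j)$, $\int_a^b=\int_0^b-\int_0^a$, and $D_qf(x)=\frac{f(x)-f(qx)}{(1-q)x}$, $D_{q^{-1}}f(x)=\frac{f(x)-f(x/q)}{(1-q^{-1})x}$ for $x\neq0$. For $\alpha>0$ put $$I_{q,0^+}^{\alpha}f(x)=\frac{x^{\alpha-1}}{\Gamma_q(\alpha)}\int_0^x(qt/x;q)_{\alpha-1}f(t)\,d_qt,\qquad I_{q,1^-}^{\alpha}f(x)=\frac{1}{\Gamma_q(\alpha)}\int_{qx}^1t^{\alpha-1}(qx/t;q)_{\alpha-1}f(t)\,d_qt,$$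 and let ${}^cD_{q,0^+}^{\mu}f=I_{q,0^+}^{1-\mu}D_qf$ and $D_{q,1^-}^{\mu}f=-\frac1q D_{q^{-1}}I_{q,1^-}^{1-\mu}f$. Consider the boundary value problem $$D_{q,1^-}^{\mu}\Big[(qx;q)_{\beta+\mu}\,{}^cD_{q,0^+}^{\mu}y\Big](x)=\lambda\,x^{-\mu}(qx;q)_\beta\,y(x),\qquad x\in A_q,$$ $$y(0)=\Big[I_{q,1^-}^{1-\mu}\,(q^{\beta+1}x;q)_\mu\,{}^cD_{q,0^+}^{\mu}y\Big]\Big(\frac1q\Big)=0.$$ A number $\lambda\in\mathbb C$ is an eigenvalue, with eigenfunction $y$, if $y:A_q^*\to\mathbb C$ is a solution of this problem that is not identically zero and is $q$-absolutely continuous, that is, $y(xq^n)\to y(0)$ as $n\to\infty$ for all $x\in A_q^*$ and there is a constant $K$ with $\sum_{j\ge0}|y(uq^j)-y(uq^{j+1})|\le K$ for all $u\in A_q^*$. For $n\in\mathbb N_0$ let $$\phi_n(x)=x^\mu p_n(x;q^\mu,q^\beta|q),\qquad p_n(x;q^\mu,q^\beta|q)=\sum_{k=0}^{n}\frac{(q^{-n};q)_k\,(q^{\mu+\beta+n+1};q)_k}{(q^{\mu+1};q)_k\,(q;q)_k}(qx)^k$$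 (little $q$-Jacobi polynomials), and $$\lambda_n=q^{-n\mu}\,\frac{\Gamma_q(\mu+\beta+n+1)\,\Gamma_q(\mu+n+1)}{\Gamma_q(\beta+n+1)\,\Gamma_q(n+1)}.$$ Then, for every $n\in\mathbb N_0$, $\lambda_n$ is an eigenvalue of the problem with eigenfunction $\phi_n$. Every eigenvalue is one of the $\lambda_n$, and every eigenfunction associated to $\lambda_n$ is a constant multiple of $\phi_n$ on $A_q^*$. -/

import Mathlib

noncomputable section

namespace QFrac

open Filter Topology

/-- The finite `q`-shifted factorial `(a; q)_k = ∏_{i<k} (1 - a q^i)`. -/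
def qPochFin (a q : ℝ) (k : ℕ) : ℝ := ∏ i ∈ Finset.range k, (1 - a * q ^ i)

/-- The infinite `q`-shifted factorial `(a; q)_∞`. -/
def qPochInf (a q : ℝ) : ℝ := ∏' i : ℕ, (1 - a * q ^ i)

/-- The `q`-shifted factorial of real order, `(a; q)_ν = (a; q)_∞ / (a q^ν; q)_∞`. -/
def qPoch (a q ν : ℝ) : ℝ := qPochInf a q / qPochInf (a * q ^ ν) q

/-- The `q`-gamma function `Γ_q(z) = (q; q)_∞ / (q^z; q)_∞ * (1 - q)^(1 - z)`. -/
def qGamma (q z : ℝ) : ℝ := qPochInf q q / qPochInf (q ^ z) q * (1 - q) ^ (1 - z)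

/-- The basic hypergeometric series `₂φ₁(a, b; c; q, z)`. -/
def basicHyp21 (a b c q z : ℝ) : ℝ :=
  ∑' k : ℕ, qPochFin a q k * qPochFin b q k / (qPochFin c q k * qPochFin q q k) * z ^ k

/-- The little `q`-Jacobi polynomial
`p_n(x; q^α, q^β | q) = ₂φ₁(q^{-n}, q^{α+β+n+1}; q^{α+1}; q, q x)`. -/
def littleQJacobi (q α β : ℝ) (n : ℕ) (x : ℝ) : ℝ :=
  basicHyp21 (q ^ (-(n : ℝ))) (q ^ (α + β + n + 1)) (q ^ (α + 1)) q (q * x)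

/-- The Jackson `q`-integral `∫_0^b f(t) d_q t = (1 - q) ∑_{j ≥ 0} b q^j f(b q^j)`. -/
def jacksonZero (q b : ℝ) (f : ℝ → ℂ) : ℂ :=
  ((1 - q : ℝ) : ℂ) * ∑' j : ℕ, ((b * q ^ j : ℝ) : ℂ) * f (b * q ^ j)

/-- The Jackson `q`-integral `∫_a^b f(t) d_q t`. -/
def jackson (q a b : ℝ) (f : ℝ → ℂ) : ℂ := jacksonZero q b f - jacksonZero q a f

/-- The Jackson `q`-difference operator `D_q f(x) = (f(x) - f(q x)) / ((1 - q) x)` at `x ≠ 0`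
(the only points at which it is used below); the base may be `q` or `q⁻¹`. -/
def qDiff (q : ℝ) (f : ℝ → ℂ) (x : ℝ) : ℂ := (f x - f (q * x)) / (((1 - q) * x : ℝ) : ℂ)

/-- The left-sided Riemann–Liouville `q`-fractional integral, based at `0`, at `x ≠ 0`:
`I_{q,0+}^α f(x) = x^{α-1} / Γ_q(α) ∫_0^x (q t / x; q)_{α-1} f(t) d_q t`. -/
def leftInt (q α : ℝ) (f : ℝ → ℂ) (x : ℝ) : ℂ :=
  ((x ^ (α - 1) / qGamma q α : ℝ) : ℂ) *
    jackson q 0 x (fun t => ((qPoch (q * t / x) q (α - 1) : ℝ) : ℂ) * f t)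

/-- The right-sided Riemann–Liouville `q`-fractional integral, based at `b`:
`I_{q,b-}^α f(x) = 1 / Γ_q(α) ∫_{q x}^b t^{α-1} (q x / t; q)_{α-1} f(t) d_q t`. -/
def rightInt (q b α : ℝ) (f : ℝ → ℂ) (x : ℝ) : ℂ :=
  ((1 / qGamma q α : ℝ) : ℂ) *
    jackson q (q * x) b
      (fun t => ((t ^ (α - 1) * qPoch (q * x / t) q (α - 1) : ℝ) : ℂ) * f t)

/-- The left-sided Caputo `q`-fractional derivative of order `α ∈ (0, 1)`,
`I_{q,0+}^{1-α} D_q f`. -/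
def leftCaputo (q α : ℝ) (f : ℝ → ℂ) (x : ℝ) : ℂ := leftInt q (1 - α) (qDiff q f) x

/-- The right-sided Riemann–Liouville `q`-fractional derivative of order `α ∈ (0, 1)`,
`(-1/q) D_{q⁻¹} I_{q,b-}^{1-α} f`. -/
def rightRL (q b α : ℝ) (f : ℝ → ℂ) (x : ℝ) : ℂ :=
  ((-1 / q : ℝ) : ℂ) * qDiff q⁻¹ (rightInt q b (1 - α) f) x

/-- The set `A_q = {q^m : m ∈ ℕ₀}`. -/
def qSet (q : ℝ) : Set ℝ := Set.range (fun m : ℕ => q ^ m)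

/-- The set `A_q^* = A_q ∪ {0}`. -/
def qSetStar (q : ℝ) : Set ℝ := qSet q ∪ {0}

/-- `q`-regularity at zero of a function on `A_q^*`. -/
def QRegular (q : ℝ) (f : ℝ → ℂ) : Prop :=
  ∀ x ∈ qSetStar q, Tendsto (fun n : ℕ => f (x * q ^ n)) atTop (𝓝 (f 0))

/-- `q`-absolutely continuous functions on `A_q^*`: `q`-regular at zero and
`∑_j |f(u q^j) - f(u q^{j+1})| ≤ K` for all `u ∈ A_q^*`, with `K` depending only on `f`. -/
def QAbsCont (q : ℝ) (f : ℝ → ℂ) : Prop :=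
  QRegular q f ∧ ∃ K : ℝ, ∀ u ∈ qSetStar q,
    Summable (fun j : ℕ => ‖f (u * q ^ j) - f (u * q ^ (j + 1))‖) ∧
      ∑' j : ℕ, ‖f (u * q ^ j) - f (u * q ^ (j + 1))‖ ≤ K

/-- The `q`-fractional Sturm–Liouville equation
`D_{q,1-}^μ ((q x; q)_{β+μ} ᶜD_{q,0+}^μ y)(x) = lam x^{-μ} (q x; q)_β y(x)` on `A_q`. -/
def SolvesEquation (q μ β : ℝ) (lam : ℂ) (y : ℝ → ℂ) : Prop :=
  ∀ x ∈ qSet q,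
    rightRL q 1 μ (fun t => ((qPoch (q * t) q (β + μ) : ℝ) : ℂ) * leftCaputo q μ y t) x =
      lam * ((x ^ (-μ) * qPoch (q * x) q β : ℝ) : ℂ) * y x

/-- The boundary conditions
`y(0) = [I_{q,1-}^{1-μ} (q^{β+1} x; q)_μ ᶜD_{q,0+}^μ y](1/q) = 0`. -/
def BoundaryConditions (q μ β : ℝ) (y : ℝ → ℂ) : Prop :=
  y 0 = 0 ∧
    rightInt q 1 (1 - μ)
      (fun t => ((qPoch (q ^ (β + 1) * t) q μ : ℝ) : ℂ) * leftCaputo q μ y t) (1 / q) = 0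

/-- `y` is an eigenfunction of the boundary value problem for the eigenvalue `lam`: a
`q`-absolutely continuous solution that is not identically zero on `A_q^*`. -/
def IsEigenfunction (q μ β : ℝ) (lam : ℂ) (y : ℝ → ℂ) : Prop :=
  QAbsCont q y ∧ (∃ x ∈ qSetStar q, y x ≠ 0) ∧
    SolvesEquation q μ β lam y ∧ BoundaryConditions q μ β y

/-- `φ_n(x) = x^μ p_n(x; q^μ, q^β | q)`. -/
def phi (q μ β : ℝ) (n : ℕ) (x : ℝ) : ℝ := x ^ μ * littleQJacobi q μ β n x

/-- `λ_n = q^{-nμ} Γ_q(μ+β+n+1) Γ_q(μ+n+1) / (Γ_q(β+n+1) Γ_q(n+1))`. -/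
def eigval (q μ β : ℝ) (n : ℕ) : ℝ :=
  q ^ (-(n : ℝ) * μ) * (qGamma q (μ + β + n + 1) * qGamma q (μ + n + 1)) /
    (qGamma q (β + n + 1) * qGamma q (n + 1))

end QFrac

end

namespace QFrac

open Filter Topology

/-! On the lattice x = q^m the problem is one about sequences. Put v_j = (q^{-μ};q)_j q^j / (q;q)_j.
Since y(0) = 0, summation by parts turns the left Caputo derivative into (Vy)_k = Σ_j v_j
y(q^{k+j}), up to powers of 1-q and q^k. The right derivative becomes the causal convolution with
the same v, that is, Vᵀ. So the equation reads (1-q)^{-2μ} Vᵀ W V y = λ ρ y with diagonal W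
(`innerWeight`) and ρ (`outerWeight`); this is `solvesEquation_iff`. The second boundary condition
is vacuous: its integral runs from 1 to 1.

That φ_n is a solution is seen from generating functions in m. At z = q^l the q-binomial theorem
`qBinSeries_eq` reduces those of both sides to balanced terminating sums, which `qSaalschutz`
evaluates to the same product. The points q^l accumulate at 0, so the coefficients agree
(`eq_zero_of_tsum_pow_smul_eq_zero`).

Conversely, symmetry (`latticeOp_symm`) makes an eigenfunction for λ ≠ λ_n orthogonal to φ_n with
weight ρ. Vanishing pairings with all φ_n force the vanishing of all moments Σ_m q^{nm} a_m of a
weighted sequence a. These are the values at q^n of a power series, so the same uniqueness principle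
gives completeness (`eq_zero_of_pairing_eq_zero`). Hence there are no further eigenvalues, and since
the λ_n are distinct each eigenspace is one-dimensional. -/

/-! ### Shifted factorials. -/

lemma qPochFin_zero (a q : ℝ) : qPochFin a q 0 = 1 := by simp [qPochFin]

lemma qPochFin_succ (a q : ℝ) (k : ℕ) :
    qPochFin a q (k + 1) = qPochFin a q k * (1 - a * q ^ k) := by
  simp [qPochFin, Finset.prod_range_succ]

lemma qPochFin_succ' (a q : ℝ) (k : ℕ) :
    qPochFin a q (k + 1) = (1 - a) * qPochFin (a * q) q k := by
  simp only [qPochFin, Finset.prod_range_succ', pow_zero, mul_one]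
  rw [mul_comm]
  congr 1
  refine Finset.prod_congr rfl fun i _ => ?_
  ring

lemma mul_pow_lt_one {q a : ℝ} (hq0 : 0 < q) (hq1 : q < 1) (ha : a < 1) (i : ℕ) :
    a * q ^ i < 1 := by
  have h1 : q ^ i ≤ 1 := pow_le_one₀ hq0.le hq1.le
  have h2 : 0 < q ^ i := pow_pos hq0 i
  rcases le_or_gt a 0 with h | h <;> nlinarith

lemma qPochFin_pos {q a : ℝ} (hq0 : 0 < q) (hq1 : q < 1) (ha : a < 1) (k : ℕ) :
    0 < qPochFin a q k :=
  Finset.prod_pos fun i _ => by linarith [mul_pow_lt_one hq0 hq1 ha i]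

lemma summable_mul_pow {q : ℝ} (hq0 : 0 < q) (hq1 : q < 1) (a : ℝ) :
    Summable fun i : ℕ => a * q ^ i :=
  (summable_geometric_of_lt_one hq0.le hq1).mul_left a

lemma multipliable_qPoch {q : ℝ} (hq0 : 0 < q) (hq1 : q < 1) (a : ℝ) :
    Multipliable fun i : ℕ => 1 - a * q ^ i := by
  have := Real.multipliable_one_add_of_summable (summable_mul_pow hq0 hq1 a).neg
  simpa [sub_eq_add_neg] using this

lemma tendsto_qPochFin {q : ℝ} (hq0 : 0 < q) (hq1 : q < 1) (a : ℝ) :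
    Tendsto (qPochFin a q) atTop (𝓝 (qPochInf a q)) :=
  (multipliable_qPoch hq0 hq1 a).hasProd.tendsto_prod_nat

lemma qPochFin_add (a q : ℝ) (k j : ℕ) :
    qPochFin a q (k + j) = qPochFin a q k * qPochFin (a * q ^ k) q j := by
  simp only [qPochFin, Finset.prod_range_add]
  congr 1
  refine Finset.prod_congr rfl fun i _ => ?_
  ring

lemma qPochInf_split {q : ℝ} (hq0 : 0 < q) (hq1 : q < 1) (a : ℝ) (k : ℕ) :
    qPochInf a q = qPochFin a q k * qPochInf (a * q ^ k) q := by
  refine tendsto_nhds_unique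
    ((tendsto_add_atTop_iff_nat k).2 (tendsto_qPochFin hq0 hq1 a)) ?_
  have := (tendsto_qPochFin hq0 hq1 (a * q ^ k)).const_mul (qPochFin a q k)
  refine this.congr fun j => ?_
  rw [add_comm j k, qPochFin_add]

lemma qPochInf_pos {q a : ℝ} (hq0 : 0 < q) (hq1 : q < 1) (ha : a < 1) :
    0 < qPochInf a q := by
  have hne : qPochInf a q ≠ 0 := by
    have := tprod_one_add_ne_zero_of_summable (f := fun i : ℕ => -(a * q ^ i))
      (fun i => by have := mul_pow_lt_one hq0 hq1 ha i; intro h; linarith)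
      (summable_mul_pow hq0 hq1 a).neg.norm
    simpa [qPochInf, sub_eq_add_neg] using this
  refine lt_of_le_of_ne (ge_of_tendsto' (tendsto_qPochFin hq0 hq1 a) fun k => ?_) hne.symm
  exact (qPochFin_pos hq0 hq1 ha k).le

lemma qPochFin_eq_zero {q a : ℝ} {i k : ℕ} (h : a * q ^ i = 1) (hik : i < k) :
    qPochFin a q k = 0 :=
  Finset.prod_eq_zero (Finset.mem_range.2 hik) (by rw [h, sub_self])

lemma qPochInf_eq_zero {q a : ℝ} (hq0 : 0 < q) (hq1 : q < 1) {i : ℕ} (h : a * q ^ i = 1) :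
    qPochInf a q = 0 := by
  rw [qPochInf_split hq0 hq1 a (i + 1), qPochFin_eq_zero h i.lt_succ_self, zero_mul]

/-! ### The q-binomial theorem. -/

/-- The coefficients `(a; q)_j / (q; q)_j` of the `q`-binomial series. -/
noncomputable def qBinCoeff (a q : ℝ) (j : ℕ) : ℝ := qPochFin a q j / qPochFin q q j

lemma qBinCoeff_zero (a q : ℝ) : qBinCoeff a q 0 = 1 := by simp [qBinCoeff, qPochFin_zero]

lemma exists_qBinCoeff_bound {q : ℝ} (hq0 : 0 < q) (hq1 : q < 1) (a : ℝ) :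
    ∃ M : ℝ, 0 ≤ M ∧ ∀ j, |qBinCoeff a q j| ≤ M := by
  have h : Tendsto (qBinCoeff a q) atTop (𝓝 (qPochInf a q / qPochInf q q)) :=
    (tendsto_qPochFin hq0 hq1 a).div (tendsto_qPochFin hq0 hq1 q) (qPochInf_pos hq0 hq1 hq1).ne'
  obtain ⟨M, hM⟩ := h.abs.bddAbove_range
  have hM' : ∀ j, |qBinCoeff a q j| ≤ M := fun j => hM ⟨j, rfl⟩
  exact ⟨M, (abs_nonneg _).trans (hM' 0), hM'⟩

lemma summable_qBinCoeff {q : ℝ} (hq0 : 0 < q) (hq1 : q < 1) (a : ℝ) {z : ℝ} (hz0 : 0 ≤ z)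
    (hz1 : z < 1) : Summable fun j : ℕ => ‖qBinCoeff a q j * z ^ j‖ := by
  obtain ⟨M, -, hM⟩ := exists_qBinCoeff_bound hq0 hq1 a
  refine Summable.of_nonneg_of_le (fun _ => norm_nonneg _) (fun j => ?_)
    ((summable_geometric_of_lt_one hz0 hz1).mul_left M)
  rw [norm_mul, norm_pow, Real.norm_of_nonneg hz0]
  exact mul_le_mul_of_nonneg_right (hM j) (pow_nonneg hz0 j)

lemma qBinCoeff_succ {q : ℝ} (hq0 : 0 < q) (hq1 : q < 1) (a : ℝ) (j : ℕ) :
    qBinCoeff a q (j + 1) * (1 - q ^ (j + 1)) = qBinCoeff a q j * (1 - a * q ^ j) := by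
  have h1 : 0 < qPochFin q q j := qPochFin_pos hq0 hq1 hq1 j
  have h2 : 0 < 1 - q ^ (j + 1) := by
    linarith [pow_lt_one₀ hq0.le hq1 (n := j + 1) j.succ_ne_zero]
  rw [qBinCoeff, qBinCoeff, qPochFin_succ, qPochFin_succ, ← pow_succ' q j]
  field_simp

/-- Coefficientwise form of (1-z)·(aqz;q)_∞/(z;q)_∞ = (aqz;q)_∞/(qz;q)_∞. It lets a difference
operator turn the kernel of the integral of order 1-μ into `fracKernel`. -/
lemma qBinCoeff_mul_sub {q : ℝ} (hq0 : 0 < q) (hq1 : q < 1) (a : ℝ) (j : ℕ) :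
    qBinCoeff (a * q) q (j + 1) - qBinCoeff (a * q) q j = qBinCoeff a q (j + 1) * q ^ (j + 1) := by
  have h1 : 0 < qPochFin q q j := qPochFin_pos hq0 hq1 hq1 j
  have h2 : 0 < 1 - q ^ (j + 1) := by
    linarith [pow_lt_one₀ hq0.le hq1 (n := j + 1) j.succ_ne_zero]
  simp only [qBinCoeff]
  rw [qPochFin_succ (a * q), qPochFin_succ q, qPochFin_succ' a, ← pow_succ' q j]
  field_simp
  ring

/-- The functional equation of the `q`-binomial series. -/
lemma qBinSeries_functional {q : ℝ} (hq0 : 0 < q) (hq1 : q < 1) (a : ℝ) {z : ℝ} (hz0 : 0 ≤ z)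
    (hz1 : z < 1) :
    (1 - z) * ∑' j : ℕ, qBinCoeff a q j * z ^ j =
      (1 - a * z) * ∑' j : ℕ, qBinCoeff a q j * (q * z) ^ j := by
  have hqz : q * z < 1 := by nlinarith
  have s1 := (summable_qBinCoeff hq0 hq1 a hz0 hz1).of_norm
  have s2 := (summable_qBinCoeff hq0 hq1 a (mul_nonneg hq0.le hz0) hqz).of_norm
  have e : ∑' j : ℕ, (qBinCoeff a q j * z ^ j - qBinCoeff a q j * (q * z) ^ j) =
      ∑' j : ℕ, (z * (qBinCoeff a q j * z ^ j) - a * z * (qBinCoeff a q j * (q * z) ^ j)) := by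
    rw [(s1.sub s2).tsum_eq_zero_add]
    simp only [pow_zero, mul_one, sub_self, zero_add]
    refine tsum_congr fun j => ?_
    have := qBinCoeff_succ hq0 hq1 a j
    rw [mul_pow, mul_pow]
    linear_combination z ^ (j + 1) * this
  rw [s1.tsum_sub s2, (s1.mul_left z).tsum_sub (s2.mul_left (a * z)), tsum_mul_left,
    tsum_mul_left] at e
  linarith

lemma qBinSeries_iterate {q : ℝ} (hq0 : 0 < q) (hq1 : q < 1) (a : ℝ) {z : ℝ} (hz0 : 0 ≤ z)
    (hz1 : z < 1) (N : ℕ) :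
    qPochFin z q N * ∑' j : ℕ, qBinCoeff a q j * z ^ j =
      qPochFin (a * z) q N * ∑' j : ℕ, qBinCoeff a q j * (z * q ^ N) ^ j := by
  induction N with
  | zero => simp [qPochFin_zero]
  | succ N ih =>
    have hp : 0 < q ^ N := pow_pos hq0 N
    have := qBinSeries_functional hq0 hq1 a (z := z * q ^ N) (by positivity)
      (mul_pow_lt_one hq0 hq1 hz1 N)
    rw [show q * (z * q ^ N) = z * q ^ (N + 1) by ring] at this
    rw [qPochFin_succ, qPochFin_succ]
    linear_combination (1 - z * q ^ N) * ih + qPochFin (a * z) q N * this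

/-- The `q`-binomial theorem. -/
theorem qBinSeries_eq {q : ℝ} (hq0 : 0 < q) (hq1 : q < 1) (a : ℝ) {z : ℝ} (hz0 : 0 ≤ z)
    (hz1 : z < 1) :
    ∑' j : ℕ, qBinCoeff a q j * z ^ j = qPochInf (a * z) q / qPochInf z q := by
  rw [eq_div_iff (qPochInf_pos hq0 hq1 hz1).ne', mul_comm]
  -- As N → ∞ the iterated functional equation leaves only the constant term of the series at z q^N.
  have hlim : Tendsto (fun N : ℕ => ∑' j : ℕ, qBinCoeff a q j * (z * q ^ N) ^ j) atTop
      (𝓝 (∑' j : ℕ, qBinCoeff a q j * (0 : ℝ) ^ j)) := by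
    refine tendsto_tsum_of_dominated_convergence (summable_qBinCoeff hq0 hq1 a hz0 hz1)
      (fun j => ?_) (Eventually.of_forall fun N j => ?_)
    · have : Tendsto (fun N : ℕ => z * q ^ N) atTop (𝓝 (z * 0)) :=
        (tendsto_pow_atTop_nhds_zero_of_lt_one hq0.le hq1).const_mul z
      rw [mul_zero] at this
      exact (this.pow j).const_mul _
    · have hp : 0 < q ^ N := pow_pos hq0 N
      rw [norm_mul, norm_mul, norm_pow, norm_pow, Real.norm_of_nonneg hz0,
        Real.norm_of_nonneg (mul_nonneg hz0 hp.le)]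
      gcongr
      exact mul_le_of_le_one_right hz0 (pow_le_one₀ hq0.le hq1.le)
  have h0 : ∑' j : ℕ, qBinCoeff a q j * (0 : ℝ) ^ j = 1 := by
    rw [tsum_eq_single 0 fun j hj => by simp [hj]]
    simp [qBinCoeff_zero]
  rw [h0] at hlim
  have h1 := (tendsto_qPochFin hq0 hq1 (a * z)).mul hlim
  rw [mul_one] at h1
  refine tendsto_nhds_unique ?_ h1
  refine ((tendsto_qPochFin hq0 hq1 z).mul_const _).congr fun N => ?_
  exact qBinSeries_iterate hq0 hq1 a hz0 hz1 N

/-! ### The q-Pfaff–Saalschütz sum. -/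

/-- The telescoping form of the recurrence in `n` of the balanced sum. -/
lemma saalschutz_telescope {q X A b c d : ℝ} (hq0 : 0 < q) (hq1 : q < 1) (hX : 0 < X)
    (hc0 : 0 < c) (hc1 : c < 1) (hd1 : d < 1) (hcd : c * d = A * b * q) (N : ℕ) :
    ∑ i ∈ Finset.range (N + 1),
      ((1 - c * X) * (1 - d * X) * (qPochFin (X * q)⁻¹ q i * qPochFin (A * (X * q)) q i *
          qPochFin b q i / (qPochFin q q i * qPochFin c q i * qPochFin d q i) * q ^ i) -
        (b - c * X) * (1 - A * q * X / c) * (qPochFin X⁻¹ q i * qPochFin (A * X) q i *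
          qPochFin b q i / (qPochFin q q i * qPochFin c q i * qPochFin d q i) * q ^ i)) =
      (1 - A * q * X ^ 2) * qPochFin X⁻¹ q N * qPochFin (A * (X * q)) q N * qPochFin b q (N + 1) /
        (qPochFin q q N * qPochFin c q N * qPochFin d q N) := by
  -- `X` stands for q^n: the two summands are the i-th terms of the sums for n+1 and n. Eliminating
  -- `d` by the balance condition makes each induction step a rational identity.
  have hd : d = A * b * q / c := by field_simp; linarith
  induction N with
  | zero =>
    simp only [zero_add, Finset.range_one, Finset.sum_singleton, qPochFin_zero, qPochFin_succ]
    rw [hd]; field_simp; ring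
  | succ N ih =>
    rw [Finset.sum_range_succ, ih]
    have hX' : X⁻¹ = (X * q)⁻¹ * q := by field_simp
    have e1 : qPochFin (X * q)⁻¹ q (N + 1) = (1 - (X * q)⁻¹) * qPochFin X⁻¹ q N := by
      rw [qPochFin_succ', ← hX']
    have e2 : qPochFin (A * X) q (N + 1) = (1 - A * X) * qPochFin (A * (X * q)) q N := by
      rw [qPochFin_succ']; ring_nf
    rw [e1, e2, qPochFin_succ X⁻¹, qPochFin_succ (A * (X * q)), qPochFin_succ b q (N + 1),
      qPochFin_succ q, qPochFin_succ c, qPochFin_succ d]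
    have p1 := qPochFin_pos hq0 hq1 hq1 N
    have p2 := qPochFin_pos hq0 hq1 hc1 N
    have p3 := qPochFin_pos hq0 hq1 hd1 N
    have r1 : 1 - q * q ^ N ≠ 0 := by linarith [mul_pow_lt_one hq0 hq1 hq1 N]
    have r2 : 1 - c * q ^ N ≠ 0 := by linarith [mul_pow_lt_one hq0 hq1 hc1 N]
    have r3 : 1 - d * q ^ N ≠ 0 := by linarith [mul_pow_lt_one hq0 hq1 hd1 N]
    generalize qPochFin X⁻¹ q N = P1 at *
    generalize qPochFin (A * (X * q)) q N = P2 at *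
    generalize qPochFin b q (N + 1) = P3 at *
    generalize qPochFin q q N = D1 at *
    generalize qPochFin c q N = D2 at *
    generalize qPochFin d q N = D3 at *
    rw [pow_succ q N]
    clear ih
    generalize q ^ N = Y at *
    subst hd
    have r4 : c - A * q * b * Y ≠ 0 := by
      intro h
      apply r3
      field_simp
      linarith
    field_simp
    ring

/-- The `q`-Pfaff–Saalschütz sum. -/
theorem qSaalschutz {q A b c d : ℝ} (hq0 : 0 < q) (hq1 : q < 1)
    (hc0 : 0 < c) (hc1 : c < 1) (hd1 : d < 1) (hcd : c * d = A * b * q) (n : ℕ) :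
    ∑ i ∈ Finset.range (n + 1), qPochFin (q ^ n)⁻¹ q i * qPochFin (A * q ^ n) q i *
          qPochFin b q i / (qPochFin q q i * qPochFin c q i * qPochFin d q i) * q ^ i =
      (∏ i ∈ Finset.range n, (b - c * q ^ i)) * qPochFin (A * q / c) q n /
        (qPochFin c q n * qPochFin d q n) := by
  induction n with
  | zero => simp [qPochFin_zero]
  | succ n ih =>
    have hX : 0 < q ^ n := pow_pos hq0 n
    have h := saalschutz_telescope hq0 hq1 hX hc0 hc1 hd1 hcd (n + 1)
    -- This factor kills both the telescoped right-hand side and the surplus last term of the sum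
    -- for n, leaving a first-order recurrence.
    have hz : qPochFin (q ^ n)⁻¹ q (n + 1) = 0 :=
      qPochFin_eq_zero (i := n) (inv_mul_cancel₀ hX.ne') n.lt_succ_self
    rw [Finset.sum_sub_distrib, ← Finset.mul_sum, ← Finset.mul_sum,
      Finset.sum_range_succ (fun i => qPochFin (q ^ n)⁻¹ q i * _ * _ / _ * _), ih, hz,
      ← pow_succ] at h
    have r2 : 1 - c * q ^ n ≠ 0 := by linarith [mul_pow_lt_one hq0 hq1 hc1 n]
    have r3 : 1 - d * q ^ n ≠ 0 := by linarith [mul_pow_lt_one hq0 hq1 hd1 n]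
    have p2 := qPochFin_pos hq0 hq1 hc1 n
    have p3 := qPochFin_pos hq0 hq1 hd1 n
    refine mul_left_cancel₀ (mul_ne_zero r2 r3) ?_
    rw [Finset.prod_range_succ, qPochFin_succ (A * q / c), qPochFin_succ c, qPochFin_succ d]
    simp only [mul_zero, zero_mul, zero_div, add_zero] at h
    rw [sub_eq_zero.1 h]
    have r4 : 1 - q ^ n * d ≠ 0 := by rwa [mul_comm]
    field_simp

/-! ### The fractional operators as lattice convolutions. -/

/-- Summation by parts for a bounded kernel against the increments of a null sequence. -/
lemma tsum_mul_sub_eq_tsum {u v : ℕ → ℝ} {y : ℕ → ℂ} {M : ℝ} (hu : ∀ j, |u j| ≤ M)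
    (h0 : v 0 = u 0) (hs : ∀ j, u (j + 1) - u j = v (j + 1)) (hv : Summable fun j => ‖v j‖)
    (hy : Tendsto y atTop (𝓝 0)) (hys : Summable fun j => ‖y j - y (j + 1)‖) :
    ∑' j, (u j : ℂ) * (y j - y (j + 1)) = ∑' j, (v j : ℂ) * y j := by
  have hM : 0 ≤ M := (abs_nonneg _).trans (hu 0)
  have fin : ∀ N, ∑ j ∈ Finset.range (N + 1), (u j : ℂ) * (y j - y (j + 1)) =
      ∑ j ∈ Finset.range (N + 1), (v j : ℂ) * y j - u N * y (N + 1) := by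
    intro N
    induction N with
    | zero => simp [h0]; ring
    | succ N ih =>
      rw [Finset.sum_range_succ, ih, Finset.sum_range_succ _ (N + 1), ← hs]
      push_cast
      ring
  have s1 : Summable fun j => (u j : ℂ) * (y j - y (j + 1)) := by
    refine Summable.of_norm_bounded (hys.mul_left M) fun j => ?_
    rw [norm_mul, Complex.norm_real]
    exact mul_le_mul_of_nonneg_right (hu j) (norm_nonneg _)
  obtain ⟨B, hB⟩ := hy.norm.bddAbove_range
  have hB' : ∀ j, ‖y j‖ ≤ B := fun j => hB ⟨j, rfl⟩
  have s2 : Summable fun j => (v j : ℂ) * y j := by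
    refine Summable.of_norm_bounded (hv.mul_right B) fun j => ?_
    rw [norm_mul, Complex.norm_real]
    exact mul_le_mul_of_nonneg_left (hB' j) (norm_nonneg _)
  have t1 := (tendsto_add_atTop_iff_nat 1).2 s1.hasSum.tendsto_sum_nat
  have t2 := (tendsto_add_atTop_iff_nat 1).2 s2.hasSum.tendsto_sum_nat
  have t3 : Tendsto (fun N => (u N : ℂ) * y (N + 1)) atTop (𝓝 0) := by
    have := ((tendsto_add_atTop_iff_nat 1).2 hy).norm.const_mul M
    rw [norm_zero, mul_zero] at this
    refine squeeze_zero_norm (fun N => ?_) this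
    rw [norm_mul, Complex.norm_real]
    exact mul_le_mul_of_nonneg_right (hu N) (norm_nonneg _)
  have t4 := t2.sub t3
  rw [sub_zero] at t4
  exact tendsto_nhds_unique t1 (t4.congr fun N => (fin N).symm)

lemma rpow_lt_one_of_pos {q s : ℝ} (hq0 : 0 < q) (hq1 : q < 1) (hs : 0 < s) : q ^ s < 1 :=
  Real.rpow_lt_one hq0.le hq1 hs

lemma mul_rpow_lt_one {q ν : ℝ} (hq0 : 0 < q) (hq1 : q < 1) (hν : -1 < ν) : q * q ^ ν < 1 := by
  rw [← Real.rpow_one_add' hq0.le (by linarith)]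
  exact rpow_lt_one_of_pos hq0 hq1 (by linarith)

/-- Splitting j factors off both infinite products makes the real-order symbol at a lattice point a
constant times a q-binomial coefficient. -/
lemma qPoch_pow_succ {q ν : ℝ} (hq0 : 0 < q) (hq1 : q < 1) (hν : -1 < ν) (j : ℕ) :
    qPoch (q ^ (j + 1)) q ν = qPoch q q ν * qBinCoeff (q * q ^ ν) q j := by
  have hc := mul_rpow_lt_one hq0 hq1 hν
  have e1 := qPochInf_split hq0 hq1 q j
  have e2 := qPochInf_split hq0 hq1 (q * q ^ ν) j
  have p1 := qPochFin_pos hq0 hq1 hq1 j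
  have p2 := qPochFin_pos hq0 hq1 hc j
  have p3 := qPochInf_pos hq0 hq1 (mul_pow_lt_one hq0 hq1 hc j)
  rw [qPoch, qPoch, qBinCoeff, e1, e2, show q ^ (j + 1) = q * q ^ j by ring,
    show q * q ^ j * q ^ ν = q * q ^ ν * q ^ j by ring]
  field_simp

lemma qPoch_pos {q ν : ℝ} (hq0 : 0 < q) (hq1 : q < 1) (hν : -1 < ν) (j : ℕ) :
    0 < qPoch (q ^ (j + 1)) q ν := by
  have hc := mul_rpow_lt_one hq0 hq1 hν
  rw [qPoch_pow_succ hq0 hq1 hν]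
  exact mul_pos (div_pos (qPochInf_pos hq0 hq1 hq1) (qPochInf_pos hq0 hq1 hc))
    (div_pos (qPochFin_pos hq0 hq1 hc j) (qPochFin_pos hq0 hq1 hq1 j))

/-- The kernel of the fractional `q`-derivatives of order `μ` on the lattice `q^m`. -/
noncomputable def fracKernel (q μ : ℝ) (j : ℕ) : ℝ := qBinCoeff (q ^ (-μ)) q j * q ^ j

lemma summable_fracKernel {q : ℝ} (hq0 : 0 < q) (hq1 : q < 1) (μ : ℝ) :
    Summable fun j => ‖fracKernel q μ j‖ :=
  summable_qBinCoeff hq0 hq1 _ hq0.le hq1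

/-- The lattice form of the left-sided fractional `q`-derivative. -/
noncomputable def latticeDeriv (q μ : ℝ) (y : ℝ → ℂ) (k : ℕ) : ℂ :=
  ∑' j : ℕ, (fracKernel q μ j : ℂ) * y (q ^ (k + j))

lemma qPoch_div_qGamma {q μ : ℝ} (hq0 : 0 < q) (hq1 : q < 1) (hμ1 : μ < 1) :
    qPoch q q (-μ) / qGamma q (1 - μ) = (1 - q) ^ (-μ) := by
  have e : q * q ^ (-μ) = q ^ (1 - μ) := by
    rw [← Real.rpow_one_add' hq0.le (by linarith)]; rfl
  have h1 := qPochInf_pos hq0 hq1 hq1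
  have h2 := qPochInf_pos hq0 hq1 (rpow_lt_one_of_pos hq0 hq1 (s := 1 - μ) (by linarith))
  have h3 : 0 < (1 - q) ^ μ := Real.rpow_pos_of_pos (by linarith) _
  rw [qPoch, qGamma, e, sub_sub_cancel, Real.rpow_neg (by linarith)]
  field_simp

lemma qSet_pow (q : ℝ) (m : ℕ) : q ^ m ∈ qSet q := ⟨m, rfl⟩

lemma qSetStar_pow (q : ℝ) (m : ℕ) : q ^ m ∈ qSetStar q := Or.inl (qSet_pow q m)

/-- The Jackson weight cancels the denominator of D_q, so the integral sums the kernel against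
increments of y. Summation by parts then applies: absolute continuity gives convergence, and y(0) =
0 removes the boundary term at infinity. -/
lemma leftCaputo_pow {q μ : ℝ} (hq0 : 0 < q) (hq1 : q < 1) (hμ1 : μ < 1)
    {y : ℝ → ℂ} (hy : QAbsCont q y) (hy0 : y 0 = 0) (m : ℕ) :
    leftCaputo q μ y (q ^ m) =
      (((1 - q) ^ (-μ) * (q ^ m) ^ (-μ) : ℝ) : ℂ) * latticeDeriv q μ y m := by
  have hm : 0 < q ^ m := pow_pos hq0 m
  have h1q : ((1 - q : ℝ) : ℂ) ≠ 0 := by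
    rw [Complex.ofReal_ne_zero]; linarith
  obtain ⟨M, -, hM⟩ := exists_qBinCoeff_bound hq0 hq1 (q ^ (-μ) * q)
  have hreg := hy.1 _ (qSetStar_pow q m)
  rw [hy0] at hreg
  obtain ⟨K, hK⟩ := hy.2
  have abel := tsum_mul_sub_eq_tsum (v := fracKernel q μ) (y := fun j => y (q ^ m * q ^ j)) hM
    (by simp [fracKernel, qBinCoeff_zero])
    (fun j => qBinCoeff_mul_sub hq0 hq1 _ j) (summable_fracKernel hq0 hq1 μ) hreg
    (hK _ (qSetStar_pow q m)).1
  rw [leftCaputo, leftInt, jackson, jacksonZero, jacksonZero, latticeDeriv]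
  simp only [zero_mul, Complex.ofReal_zero, tsum_zero, mul_zero, sub_zero, pow_add]
  rw [← abel, show 1 - μ - 1 = -μ by ring, ← qPoch_div_qGamma hq0 hq1 hμ1]
  have term : ∀ j : ℕ, ((q ^ m * q ^ j : ℝ) : ℂ) *
      (((qPoch (q * (q ^ m * q ^ j) / q ^ m) q (-μ) : ℝ) : ℂ) * qDiff q y (q ^ m * q ^ j)) =
      (qPoch q q (-μ) : ℂ) / ((1 - q : ℝ) : ℂ) * ((qBinCoeff (q ^ (-μ) * q) q j : ℂ) *
        (y (q ^ m * q ^ j) - y (q ^ m * q ^ (j + 1)))) := by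
    intro j
    have hj : 0 < q ^ j := pow_pos hq0 j
    have e : q * (q ^ m * q ^ j) / q ^ m = q ^ (j + 1) := by field_simp; ring
    have h2 : ((q ^ m * q ^ j : ℝ) : ℂ) ≠ 0 := by
      rw [Complex.ofReal_ne_zero]; positivity
    rw [e, qPoch_pow_succ hq0 hq1 (by linarith), qDiff,
      show q * (q ^ m * q ^ j) = q ^ m * q ^ (j + 1) by ring, mul_comm q (q ^ (-μ)),
      Complex.ofReal_mul, Complex.ofReal_mul (1 - q)]
    field_simp
    push_cast
    ring
  rw [tsum_congr term, tsum_mul_left]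
  push_cast
  push_cast at h1q
  field_simp

/-- The limits of integration coincide, so the second boundary condition holds for every function.
-/
lemma rightInt_one_div {q μ : ℝ} (hq0 : 0 < q) (g : ℝ → ℂ) : rightInt q 1 μ g (1 / q) = 0 := by
  rw [rightInt, mul_one_div_cancel hq0.ne', jackson, sub_self, mul_zero]

lemma qPoch_eq_zero {q a ν : ℝ} (hq0 : 0 < q) (hq1 : q < 1) {i : ℕ} (h : a * q ^ i = 1) :
    qPoch a q ν = 0 := by
  rw [qPoch, qPochInf_eq_zero hq0 hq1 h, zero_div]

/-- At t = q^k with k > m the kernel is (q^{-i};q)_{-μ} with i = k-m-1, which contains a zero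
factor. Only k ≤ m survives, and the whole integral over [0, qx] drops out. -/
lemma rightInt_pow {q μ : ℝ} (hq0 : 0 < q) (hq1 : q < 1) (hμ1 : μ < 1) (g : ℝ → ℂ) (m : ℕ) :
    rightInt q 1 (1 - μ) g (q ^ m) = (((1 - q) * (1 - q) ^ (-μ) : ℝ) : ℂ) *
      ∑ k ∈ Finset.range (m + 1), ((qBinCoeff (q ^ (-μ) * q) q (m - k) * (q ^ k) ^ (1 - μ) : ℝ) : ℂ)
        * g (q ^ k) := by
  have hm : 0 < q ^ m := pow_pos hq0 m
  rw [rightInt, jackson, jacksonZero, jacksonZero, ← qPoch_div_qGamma hq0 hq1 hμ1,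
    show 1 - μ - 1 = -μ by ring]
  have z2 : ∀ j : ℕ, qPoch (q * q ^ m / (q * q ^ m * q ^ j)) q (-μ) = 0 := by
    intro j
    refine qPoch_eq_zero hq0 hq1 (i := j) ?_
    have hj : 0 < q ^ j := pow_pos hq0 j
    field_simp
  simp only [z2, mul_zero, Complex.ofReal_zero, zero_mul, tsum_zero, sub_zero, one_mul]
  rw [tsum_eq_sum (s := Finset.range (m + 1))]
  · rw [Finset.mul_sum, Finset.mul_sum, Finset.mul_sum]
    refine Finset.sum_congr rfl fun k hk => ?_
    have hk' : k ≤ m := Nat.lt_succ_iff.1 (Finset.mem_range.1 hk)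
    have hkp : 0 < q ^ k := pow_pos hq0 k
    have e : q * q ^ m / q ^ k = q ^ (m - k + 1) := by
      rw [pow_succ, pow_sub₀ q hq0.ne' hk']; field_simp
    rw [e, qPoch_pow_succ hq0 hq1 (by linarith), sub_eq_add_neg 1 μ,
      Real.rpow_one_add' (x := q ^ k) hkp.le (by linarith), mul_comm q (q ^ (-μ))]
    push_cast
    ring
  · intro k hk
    have hk' : m + 1 ≤ k := by simpa using hk
    rw [qPoch_eq_zero hq0 hq1 (i := k - (m + 1))]
    · simp
    · have hkp : 0 < q ^ k := pow_pos hq0 k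
      rw [pow_sub₀ q hq0.ne' hk', pow_succ]; field_simp

lemma rightRL_pow {q μ : ℝ} (hq0 : 0 < q) (hq1 : q < 1) (hμ1 : μ < 1) (g : ℝ → ℂ) (m : ℕ) :
    rightRL q 1 μ g (q ^ m) = (((1 - q) ^ (-μ) / q ^ m : ℝ) : ℂ) *
      ∑ k ∈ Finset.range (m + 1), ((fracKernel q μ (m - k) * (q ^ k) ^ (1 - μ) : ℝ) : ℂ)
        * g (q ^ k) := by
  have hqc : (q : ℂ) ≠ 0 := Complex.ofReal_ne_zero.2 hq0.ne'
  have h1q : (1 : ℂ) - q ≠ 0 := by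
    rw [← Complex.ofReal_one, ← Complex.ofReal_sub, Complex.ofReal_ne_zero]; linarith
  have h1q' : (q : ℂ) - 1 ≠ 0 := by rw [← neg_sub, neg_ne_zero]; exact h1q
  rw [rightRL, qDiff, rightInt_pow hq0 hq1 hμ1]
  cases m with
  | zero =>
    -- For m = 0 the backward neighbour 1/q lies off the lattice, and the integral there is empty.
    rw [pow_zero, mul_one, ← one_div q, rightInt_one_div hq0]
    simp only [zero_add, Finset.range_one, Finset.sum_singleton, fracKernel, qBinCoeff_zero,
      Nat.sub_self, pow_zero]
    push_cast
    field_simp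
    ring
  | succ m =>
    rw [show q⁻¹ * q ^ (m + 1) = q ^ m by field_simp; ring, rightInt_pow hq0 hq1 hμ1,
      Finset.sum_range_succ, Finset.sum_range_succ _ (m + 1)]
    have key : ∑ k ∈ Finset.range (m + 1),
        ((fracKernel q μ (m + 1 - k) * (q ^ k) ^ (1 - μ) : ℝ) : ℂ) * g (q ^ k) =
        ∑ k ∈ Finset.range (m + 1),
          ((qBinCoeff (q ^ (-μ) * q) q (m + 1 - k) * (q ^ k) ^ (1 - μ) : ℝ) : ℂ) * g (q ^ k) -
        ∑ k ∈ Finset.range (m + 1),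
          ((qBinCoeff (q ^ (-μ) * q) q (m - k) * (q ^ k) ^ (1 - μ) : ℝ) : ℂ) * g (q ^ k) := by
      rw [← Finset.sum_sub_distrib]
      refine Finset.sum_congr rfl fun k hk => ?_
      have hk' : k ≤ m := Nat.lt_succ_iff.1 (Finset.mem_range.1 hk)
      rw [Nat.succ_sub hk', Nat.succ_eq_add_one, fracKernel, ← qBinCoeff_mul_sub hq0 hq1]
      push_cast
      ring
    rw [key]
    simp only [fracKernel, qBinCoeff_zero, Nat.sub_self, pow_zero]
    push_cast
    field_simp
    ring

/-- The weight of the symmetric form of the equation. -/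
noncomputable def innerWeight (q μ β : ℝ) (k : ℕ) : ℝ :=
  (q ^ k) ^ (1 - 2 * μ) * qPoch (q ^ (k + 1)) q (β + μ)

/-- The orthogonality weight on the lattice. -/
noncomputable def outerWeight (q μ β : ℝ) (m : ℕ) : ℝ :=
  (q ^ m) ^ (1 - μ) * qPoch (q ^ (m + 1)) q β

/-- The equation on the lattice `q^m` in symmetric form. -/
lemma solvesEquation_iff {q μ β : ℝ} (hq0 : 0 < q) (hq1 : q < 1) (hμ1 : μ < 1) (lam : ℂ)
    {y : ℝ → ℂ} (hy : QAbsCont q y) (hy0 : y 0 = 0) :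
    SolvesEquation q μ β lam y ↔ ∀ m : ℕ, (((1 - q) ^ (-(2 * μ)) : ℝ) : ℂ) *
      ∑ k ∈ Finset.range (m + 1), (fracKernel q μ (m - k) : ℂ) *
        ((innerWeight q μ β k : ℂ) * latticeDeriv q μ y k) =
      lam * ((outerWeight q μ β m : ℂ) * y (q ^ m)) := by
  rw [SolvesEquation, qSet, Set.forall_mem_range]
  refine forall_congr' fun m => ?_
  have hm : 0 < q ^ m := pow_pos hq0 m
  have hmc : ((q ^ m : ℝ) : ℂ) ≠ 0 := Complex.ofReal_ne_zero.2 hm.ne'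
  have h1 : (1 - q) ^ (-(2 * μ)) = (1 - q) ^ (-μ) * (1 - q) ^ (-μ) := by
    rw [← Real.rpow_add (by linarith)]; congr 1; ring
  -- Multiplying the equation by q^m clears the factor 1/q^m of the right derivative, so that both
  -- convolutions carry exactly the kernel `fracKernel`.
  have eL : (((1 - q) ^ (-(2 * μ)) : ℝ) : ℂ) *
      ∑ k ∈ Finset.range (m + 1), (fracKernel q μ (m - k) : ℂ) *
        ((innerWeight q μ β k : ℂ) * latticeDeriv q μ y k) = ((q ^ m : ℝ) : ℂ) *
      rightRL q 1 μ (fun t => ((qPoch (q * t) q (β + μ) : ℝ) : ℂ) * leftCaputo q μ y t) (q ^ m) := by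
    rw [rightRL_pow hq0 hq1 hμ1, h1, ← mul_assoc, ← Complex.ofReal_mul, mul_div_cancel₀ _ hm.ne',
      Complex.ofReal_mul ((1 - q) ^ (-μ)), mul_assoc, Finset.mul_sum]
    congr 1
    refine Finset.sum_congr rfl fun k _ => ?_
    have hk : 0 < q ^ k := pow_pos hq0 k
    rw [leftCaputo_pow hq0 hq1 hμ1 hy hy0, innerWeight, ← pow_succ' q k,
      show 1 - 2 * μ = (1 - μ) + (-μ) by ring, Real.rpow_add hk]
    push_cast
    ring
  have eR : lam * ((outerWeight q μ β m : ℂ) * y (q ^ m)) = ((q ^ m : ℝ) : ℂ) *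
      (lam * (((q ^ m) ^ (-μ) * qPoch (q * q ^ m) q β : ℝ) : ℂ) * y (q ^ m)) := by
    rw [outerWeight, sub_eq_add_neg, Real.rpow_one_add' (x := q ^ m) hm.le (by linarith),
      ← pow_succ' q m]
    push_cast
    ring
  rw [eL, eR]
  exact ⟨fun h => by rw [h], fun h => mul_left_cancel₀ hmc h⟩

/-! ### The functions φ_n solve the lattice equation. -/

/-- An absolutely summable power series vanishing at all points `q^l` is zero. -/
lemma eq_zero_of_tsum_pow_smul_eq_zero {E : Type*} [NormedAddCommGroup E] [NormedSpace ℝ E]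
    [CompleteSpace E] {q : ℝ} (hq0 : 0 < q) (hq1 : q < 1) {a : ℕ → E}
    (ha : Summable fun m => ‖a m‖) (h : ∀ l : ℕ, ∑' m, (q ^ l) ^ m • a m = 0) (m : ℕ) :
    a m = 0 := by
  induction m using Nat.strong_induction_on with
  | _ m ih =>
    have bd : ∀ l j k : ℕ, ‖(q ^ l) ^ j • a k‖ ≤ ‖a k‖ := by
      intro l j k
      rw [norm_smul, Real.norm_of_nonneg (by positivity)]
      exact mul_le_of_le_one_left (norm_nonneg _)
        (pow_le_one₀ (by positivity) (pow_le_one₀ hq0.le hq1.le))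
    -- Once the coefficients below m vanish, divide by z^m and let z = q^l → 0 to isolate `a m`.
    have shift : ∀ l : ℕ, ∑' j, (q ^ l) ^ j • a (j + m) = 0 := by
      intro l
      have s : Summable fun k => (q ^ l) ^ k • a k := Summable.of_norm_bounded ha fun k => bd l k k
      have e := s.sum_add_tsum_nat_add m
      rw [h l, Finset.sum_eq_zero fun i hi => by rw [ih i (Finset.mem_range.1 hi), smul_zero],
        zero_add] at e
      simp_rw [pow_add, mul_comm _ ((q ^ l) ^ m), mul_smul] at e
      rw [tsum_const_smul''] at e
      exact (smul_eq_zero.1 e).resolve_left (by positivity)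
    have lim : Tendsto (fun l : ℕ => ∑' j, (q ^ l) ^ j • a (j + m)) atTop
        (𝓝 (∑' j, (0 : ℝ) ^ j • a (j + m))) := by
      refine tendsto_tsum_of_dominated_convergence ((summable_nat_add_iff m).2 ha) (fun j => ?_)
        (Eventually.of_forall fun l j => bd l j (j + m))
      exact ((tendsto_pow_atTop_nhds_zero_of_lt_one hq0.le hq1).pow j).smul_const _
    simp_rw [shift] at lim
    have := tendsto_nhds_unique lim tendsto_const_nhds
    rw [tsum_eq_single 0 fun j hj => by simp [hj]] at this
    simpa using this

/-- The coefficients of the terminating series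
`∑_i (q^{-n}; q)_i (A q^n; q)_i / ((c; q)_i (q; q)_i) (q x)^i`. -/
noncomputable def jacobiCoeff (q A c : ℝ) (n i : ℕ) : ℝ :=
  qPochFin (q ^ n)⁻¹ q i * qPochFin (A * q ^ n) q i / (qPochFin c q i * qPochFin q q i) * q ^ i

lemma littleQJacobi_eq_sum {q : ℝ} (hq0 : 0 < q) (μ β : ℝ) (n : ℕ) (x : ℝ) :
    littleQJacobi q μ β n x =
      ∑ i ∈ Finset.range (n + 1), jacobiCoeff q (q * q ^ (μ + β)) (q * q ^ μ) n i * x ^ i := by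
  have e1 : q ^ (-(n : ℝ)) = (q ^ n)⁻¹ := by rw [Real.rpow_neg hq0.le, Real.rpow_natCast]
  have e2 : q ^ (μ + β + n + 1) = q * q ^ (μ + β) * q ^ n := by
    rw [Real.rpow_add hq0, Real.rpow_add hq0, Real.rpow_natCast, Real.rpow_one]; ring
  have e3 : q ^ (μ + 1) = q * q ^ μ := by rw [Real.rpow_add hq0, Real.rpow_one, mul_comm]
  rw [littleQJacobi, basicHyp21, e1, e2, e3, tsum_eq_sum (s := Finset.range (n + 1))]
  · refine Finset.sum_congr rfl fun i _ => ?_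
    rw [jacobiCoeff, mul_pow]
    ring
  · intro i hi
    rw [qPochFin_eq_zero (i := n) (inv_mul_cancel₀ (pow_pos hq0 n).ne') (by simpa using hi)]
    simp

lemma sum_jacobiCoeff_mul {q A b c d : ℝ} (hq0 : 0 < q) (hq1 : q < 1)
    (hc0 : 0 < c) (hc1 : c < 1) (hd1 : d < 1) (hcd : c * d = A * b * q) (n : ℕ) :
    ∑ i ∈ Finset.range (n + 1), jacobiCoeff q A c n i * (qPochFin b q i / qPochFin d q i) =
      (∏ i ∈ Finset.range n, (b - c * q ^ i)) * qPochFin (A * q / c) q n /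
        (qPochFin c q n * qPochFin d q n) := by
  rw [← qSaalschutz hq0 hq1 hc0 hc1 hd1 hcd]
  refine Finset.sum_congr rfl fun i _ => ?_
  have p1 := qPochFin_pos hq0 hq1 hq1 i
  have p2 := qPochFin_pos hq0 hq1 hc1 i
  have p3 := qPochFin_pos hq0 hq1 hd1 i
  rw [jacobiCoeff]
  field_simp

lemma summable_qBinCoeff_mul_sum {q a s : ℝ} (hq0 : 0 < q) (hq1 : q < 1) (hs0 : 0 ≤ s)
    (hs1 : s < 1) (e : ℕ → ℝ) (n : ℕ) :
    Summable fun m : ℕ => qBinCoeff a q m * s ^ m * ∑ i ∈ Finset.range n, e i * (q ^ m) ^ i := by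
  have : ∀ i ∈ Finset.range n,
      Summable fun m : ℕ => e i * (qBinCoeff a q m * (s * q ^ i) ^ m) := fun i _ =>
    (summable_qBinCoeff hq0 hq1 a (by positivity) (mul_pow_lt_one hq0 hq1 hs1 i)).of_norm.mul_left _
  refine (summable_sum this).congr fun m => ?_
  rw [Finset.mul_sum]
  refine Finset.sum_congr rfl fun i _ => ?_
  ring

/-- The q-binomial theorem at s q^i for each monomial; relative to i = 0 the value changes by
(s;q)_i/(as;q)_i, the extra factors needed for a Saalschütz sum. -/
lemma tsum_qBinCoeff_mul_sum {q a s : ℝ} (hq0 : 0 < q) (hq1 : q < 1) (hs0 : 0 ≤ s)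
    (hs1 : s < 1) (has : a * s < 1) (e : ℕ → ℝ) (n : ℕ) :
    ∑' m : ℕ, qBinCoeff a q m * s ^ m * ∑ i ∈ Finset.range n, e i * (q ^ m) ^ i =
      qPochInf (a * s) q / qPochInf s q *
        ∑ i ∈ Finset.range n, e i * (qPochFin s q i / qPochFin (a * s) q i) := by
  have hsum : ∀ i ∈ Finset.range n,
      Summable fun m : ℕ => e i * (qBinCoeff a q m * (s * q ^ i) ^ m) := fun i _ =>
    (summable_qBinCoeff hq0 hq1 a (by positivity) (mul_pow_lt_one hq0 hq1 hs1 i)).of_norm.mul_left _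
  have : ∀ m : ℕ, qBinCoeff a q m * s ^ m * ∑ i ∈ Finset.range n, e i * (q ^ m) ^ i =
      ∑ i ∈ Finset.range n, e i * (qBinCoeff a q m * (s * q ^ i) ^ m) := by
    intro m
    rw [Finset.mul_sum]
    refine Finset.sum_congr rfl fun i _ => ?_
    ring
  simp_rw [this]
  rw [Summable.tsum_finsetSum hsum, Finset.mul_sum]
  refine Finset.sum_congr rfl fun i _ => ?_
  rw [tsum_mul_left, qBinSeries_eq hq0 hq1 a (by positivity) (mul_pow_lt_one hq0 hq1 hs1 i),
    qPochInf_split hq0 hq1 (a * s) i, qPochInf_split hq0 hq1 s i, ← mul_assoc a s]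
  have p1 := qPochFin_pos hq0 hq1 hs1 i
  have p2 := qPochFin_pos hq0 hq1 has i
  have p3 := qPochInf_pos hq0 hq1 (mul_pow_lt_one hq0 hq1 hs1 i)
  field_simp

lemma phi_pow {q : ℝ} (hq0 : 0 < q) (μ β : ℝ) (n m : ℕ) :
    phi q μ β n (q ^ m) = (q ^ μ) ^ m *
      ∑ i ∈ Finset.range (n + 1),
        jacobiCoeff q (q * q ^ (μ + β)) (q * q ^ μ) n i * (q ^ m) ^ i := by
  rw [phi, littleQJacobi_eq_sum hq0, ← Real.rpow_natCast_mul hq0.le, mul_comm (m : ℝ) μ,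
    Real.rpow_mul_natCast hq0.le]

/-- Since q^{-μ}·q^{μ+1} = q, the i-th monomial acquires (q^{μ+1};q)_i/(q;q)_i. The effect on the
polynomial is to replace the lower parameter q^{μ+1} by q. -/
lemma tsum_fracKernel_mul_phi {q μ : ℝ} (hq0 : 0 < q) (hq1 : q < 1) (hμ0 : 0 < μ) (β : ℝ)
    (n k : ℕ) :
    ∑' j : ℕ, fracKernel q μ j * phi q μ β n (q ^ (k + j)) =
      qPoch q q μ * (q ^ μ) ^ k *
        ∑ i ∈ Finset.range (n + 1), jacobiCoeff q (q * q ^ (μ + β)) q n i * (q ^ k) ^ i := by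
  have hμq := mul_rpow_lt_one hq0 hq1 (ν := μ) (by linarith)
  have hp : 0 < q ^ μ := Real.rpow_pos_of_pos hq0 _
  have e1 : q ^ (-μ) * (q * q ^ μ) = q := by
    rw [Real.rpow_neg hq0.le]; field_simp
  have h := tsum_qBinCoeff_mul_sum (a := q ^ (-μ)) hq0 hq1 (by positivity) hμq (by rwa [e1])
    (fun i => jacobiCoeff q (q * q ^ (μ + β)) (q * q ^ μ) n i * (q ^ k) ^ i) (n + 1)
  rw [e1] at h
  have t : ∀ j : ℕ, fracKernel q μ j * phi q μ β n (q ^ (k + j)) =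
      (q ^ μ) ^ k * (qBinCoeff (q ^ (-μ)) q j * (q * q ^ μ) ^ j * ∑ i ∈ Finset.range (n + 1),
        jacobiCoeff q (q * q ^ (μ + β)) (q * q ^ μ) n i * (q ^ k) ^ i * (q ^ j) ^ i) := by
    intro j
    rw [phi_pow hq0, fracKernel]
    simp_rw [pow_add q k j, mul_pow]
    simp only [mul_assoc, pow_add]
    ring
  simp_rw [t]
  rw [tsum_mul_left, h, qPoch]
  rw [mul_comm _ ((q ^ μ) ^ k), mul_assoc]
  congr 2
  refine Finset.sum_congr rfl fun i _ => ?_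
  have p1 := qPochFin_pos hq0 hq1 hq1 i
  have p2 := qPochFin_pos hq0 hq1 hμq i
  rw [jacobiCoeff, jacobiCoeff]
  field_simp

lemma qGamma_add_nat_add_one {q s : ℝ} (hq0 : 0 < q) (hq1 : q < 1) (hs : -1 < s) (n : ℕ) :
    qGamma q (s + n + 1) = qPoch q q s * qPochFin (q * q ^ s) q n * (1 - q) ^ (-s - n) := by
  have e : q ^ (s + n + 1) = q * q ^ s * q ^ n := by
    rw [Real.rpow_add hq0, Real.rpow_add hq0, Real.rpow_natCast, Real.rpow_one]; ring
  have hc := mul_rpow_lt_one hq0 hq1 hs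
  have p1 := qPochFin_pos hq0 hq1 hc n
  have p2 := qPochInf_pos hq0 hq1 (mul_pow_lt_one hq0 hq1 hc n)
  rw [qGamma, e, qPoch, qPochInf_split hq0 hq1 (q * q ^ s) n,
    show 1 - (s + n + 1) = -s - n by ring]
  field_simp

lemma eigval_eq {q μ β : ℝ} (hq0 : 0 < q) (hq1 : q < 1) (hμ0 : 0 < μ) (hβ : -1 < β) (n : ℕ) :
    eigval q μ β n = (1 - q) ^ (-(2 * μ)) * (q ^ (-μ)) ^ n *
      (qPoch q q (μ + β) * qPochFin (q * q ^ (μ + β)) q n *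
        (qPoch q q μ * qPochFin (q * q ^ μ) q n)) /
      (qPoch q q β * qPochFin (q * q ^ β) q n * qPochFin q q n) := by
  have h0 := qGamma_add_nat_add_one hq0 hq1 (s := 0) (by norm_num) n
  have h00 : qPoch q q 0 = 1 := by
    rw [qPoch, Real.rpow_zero, mul_one, div_self (qPochInf_pos hq0 hq1 hq1).ne']
  rw [h00, Real.rpow_zero, mul_one, zero_add, one_mul] at h0
  have hq : 0 < 1 - q := by linarith
  have e1 : q ^ (-(n : ℝ) * μ) = (q ^ (-μ)) ^ n := by
    rw [neg_mul_comm, mul_comm, Real.rpow_mul_natCast hq0.le]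
  have e2 : (1 - q) ^ (-(μ + β) - n) * (1 - q) ^ (-μ - n) =
      (1 - q) ^ (-(2 * μ)) * ((1 - q) ^ (-β - n) * (1 - q) ^ (-0 - (n : ℝ))) := by
    rw [← Real.rpow_add hq, ← Real.rpow_add hq, ← Real.rpow_add hq]; congr 1; ring
  have p1 : 0 < (1 - q) ^ (-β - n) := Real.rpow_pos_of_pos hq _
  have p2 : 0 < (1 - q) ^ (-0 - (n : ℝ)) := Real.rpow_pos_of_pos hq _
  have p3 := qPochFin_pos hq0 hq1 hq1 n
  have p4 := qPochFin_pos hq0 hq1 (mul_rpow_lt_one hq0 hq1 hβ) n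
  have p5 : 0 < qPoch q q β := by simpa using qPoch_pos hq0 hq1 hβ 0
  rw [eigval, qGamma_add_nat_add_one hq0 hq1 (by linarith), qGamma_add_nat_add_one hq0 hq1
    (by linarith), qGamma_add_nat_add_one hq0 hq1 hβ, h0, e1, div_eq_div_iff (by positivity)
    (by positivity)]
  linear_combination (q ^ (-μ)) ^ n *
      (qPoch q q (μ + β) * qPochFin (q * q ^ (μ + β)) q n *
        (qPoch q q μ * qPochFin (q * q ^ μ) q n)) *
      (qPoch q q β * qPochFin (q * q ^ β) q n * qPochFin q q n) * e2

/-- The factor x^μ carried by Vφ_n turns the weight into the general term of a q-binomial series at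
q^{1-μ} < 1. -/
lemma innerWeight_eq {q μ β : ℝ} (hq0 : 0 < q) (hq1 : q < 1) (h : -1 < μ + β) (k : ℕ) :
    innerWeight q μ β k * (q ^ μ) ^ k =
      qPoch q q (μ + β) * (qBinCoeff (q * q ^ (μ + β)) q k * (q * q ^ (-μ)) ^ k) := by
  have hk : 0 < q ^ k := pow_pos hq0 k
  rw [innerWeight, add_comm β μ, qPoch_pow_succ hq0 hq1 h,
    show 1 - 2 * μ = 1 + -μ + -μ by ring, Real.rpow_add hk, Real.rpow_add hk, Real.rpow_one,
    Real.rpow_neg hk.le, Real.rpow_neg hq0.le]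
  have e : (q ^ k) ^ μ = (q ^ μ) ^ k := by
    rw [← Real.rpow_natCast_mul hq0.le, mul_comm (k : ℝ) μ, Real.rpow_mul_natCast hq0.le]
  have : 0 < q ^ μ := Real.rpow_pos_of_pos hq0 _
  rw [e, mul_pow, inv_pow]
  field_simp

lemma outerWeight_eq {q μ β : ℝ} (hq0 : 0 < q) (hq1 : q < 1) (h : -1 < β) (k : ℕ) :
    outerWeight q μ β k * (q ^ μ) ^ k =
      qPoch q q β * (qBinCoeff (q * q ^ β) q k * q ^ k) := by
  have hk : 0 < q ^ k := pow_pos hq0 k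
  rw [outerWeight, qPoch_pow_succ hq0 hq1 h,
    show 1 - μ = 1 + -μ by ring, Real.rpow_add hk, Real.rpow_one, Real.rpow_neg hk.le]
  have e : (q ^ k) ^ μ = (q ^ μ) ^ k := by
    rw [← Real.rpow_natCast_mul hq0.le, mul_comm (k : ℝ) μ, Real.rpow_mul_natCast hq0.le]
  have : 0 < q ^ μ := Real.rpow_pos_of_pos hq0 _
  rw [e]
  field_simp

/-- Every `φ_n` satisfies the lattice equation. -/
theorem lattice_equation_phi {q μ β : ℝ} (hq0 : 0 < q) (hq1 : q < 1) (hμ0 : 0 < μ) (hμ1 : μ < 1)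
    (hβ : -1 < β) (n m : ℕ) :
    (1 - q) ^ (-(2 * μ)) * ∑ k ∈ Finset.range (m + 1), fracKernel q μ (m - k) *
        (innerWeight q μ β k * ∑' j : ℕ, fracKernel q μ j * phi q μ β n (q ^ (k + j))) =
      eigval q μ β n * (outerWeight q μ β m * phi q μ β n (q ^ m)) := by
  set κ := (1 - q) ^ (-(2 * μ)) with hκ
  set A := q * q ^ (μ + β) with hA
  set c : ℕ → ℝ := jacobiCoeff q A (q * q ^ μ) n with hc
  set d : ℕ → ℝ := jacobiCoeff q A q n with hd
  have hμβ : -1 < μ + β := by linarith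
  have hqμ : q * q ^ μ < 1 := mul_rpow_lt_one hq0 hq1 (by linarith)
  have hqmμ : q * q ^ (-μ) < 1 := mul_rpow_lt_one hq0 hq1 (by linarith)
  have hqβ : q * q ^ β < 1 := mul_rpow_lt_one hq0 hq1 hβ
  have pμ : 0 < q ^ μ := Real.rpow_pos_of_pos hq0 _
  have pβ : 0 < q ^ β := Real.rpow_pos_of_pos hq0 _
  have emμ : q ^ (-μ) = (q ^ μ)⁻¹ := Real.rpow_neg hq0.le _
  have pmμ : 0 < q ^ (-μ) := Real.rpow_pos_of_pos hq0 _
  have eμβ : q ^ (μ + β) = q ^ μ * q ^ β := Real.rpow_add hq0 _ _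
  set g : ℕ → ℝ := fun k => qBinCoeff A q k * (q * q ^ (-μ)) ^ k *
    ∑ i ∈ Finset.range (n + 1), d i * (q ^ k) ^ i with hg
  set r : ℕ → ℝ := fun k => qBinCoeff (q * q ^ β) q k * q ^ k *
    ∑ i ∈ Finset.range (n + 1), c i * (q ^ k) ^ i with hr
  have eg : ∀ k, innerWeight q μ β k * ∑' j : ℕ, fracKernel q μ j * phi q μ β n (q ^ (k + j)) =
      qPoch q q μ * qPoch q q (μ + β) * g k := by
    intro k
    rw [tsum_fracKernel_mul_phi hq0 hq1 hμ0]
    simp only [hg]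
    linear_combination qPoch q q μ * (∑ i ∈ Finset.range (n + 1), d i * (q ^ k) ^ i) *
      innerWeight_eq hq0 hq1 hμβ k
  have er : outerWeight q μ β m * phi q μ β n (q ^ m) = qPoch q q β * r m := by
    rw [phi_pow hq0]
    simp only [hr]
    linear_combination (∑ i ∈ Finset.range (n + 1), c i * (q ^ m) ^ i) *
      outerWeight_eq (μ := μ) hq0 hq1 hβ m
  simp_rw [eg]
  rw [er]
  have sg : Summable fun k => ‖g k‖ :=
    (summable_qBinCoeff_mul_sum hq0 hq1 (by positivity) hqmμ _ _).norm
  have sr : Summable fun k => ‖r k‖ :=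
    (summable_qBinCoeff_mul_sum hq0 hq1 hq0.le hq1 _ _).norm
  have sv := summable_fracKernel hq0 hq1 μ
  set C1 := κ * (qPoch q q μ * qPoch q q (μ + β)) with hC1
  set C2 := eigval q μ β n * qPoch q q β with hC2
  have sconv := summable_norm_sum_mul_antidiagonal_of_summable_norm sv sg
  -- Both sides are absolutely summable in m, so it suffices to compare their generating functions
  -- at z = q^l.
  have key := eq_zero_of_tsum_pow_smul_eq_zero hq0 hq1
    (a := fun m => C1 * (∑ kl ∈ Finset.HasAntidiagonal.antidiagonal m, fracKernel q μ kl.1 * g kl.2) - C2 * r m)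
    ((sconv.of_norm.mul_left C1).sub (sr.of_norm.mul_left C2)).norm ?_ m
  · simp only [Finset.Nat.sum_antidiagonal_eq_sum_range_succ_mk] at key
    rw [← Finset.sum_range_reflect] at key
    have e : ∑ k ∈ Finset.range (m + 1), fracKernel q μ (m - k) *
        (qPoch q q μ * qPoch q q (μ + β) * g k) = (qPoch q q μ * qPoch q q (μ + β)) *
        ∑ j ∈ Finset.range m.succ, fracKernel q μ (m.succ - 1 - j) * g (m - (m.succ - 1 - j)) := by
      rw [Finset.mul_sum]
      refine Finset.sum_congr rfl fun k hk => ?_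
      have hk' : k ≤ m := Nat.lt_succ_iff.1 (Finset.mem_range.1 hk)
      rw [Nat.succ_sub_one, Nat.sub_sub_self hk']
      ring
    rw [e]
    linear_combination key
  · intro l
    set z := q ^ l with hz
    have hz0 : 0 < z := pow_pos hq0 l
    have hz1 : z ≤ 1 := pow_le_one₀ hq0.le hq1.le
    have hle : ∀ {t : ℝ}, 0 < t → t < 1 → t * z < 1 := fun h0 h1 => by nlinarith
    have bdz : ∀ (j : ℕ) (t : ℝ), ‖z ^ j * t‖ ≤ ‖t‖ := by
      intro j t
      rw [norm_mul, Real.norm_of_nonneg (by positivity)]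
      exact mul_le_of_le_one_left (norm_nonneg _) (pow_le_one₀ hz0.le hz1)
    have sgz : Summable fun k => ‖z ^ k * g k‖ :=
      Summable.of_nonneg_of_le (fun _ => norm_nonneg _) (fun k => bdz k _) sg
    have srz : Summable fun k => z ^ k * r k := Summable.of_norm_bounded sr fun k => bdz k _
    have svz : Summable fun k => ‖z ^ k * fracKernel q μ k‖ :=
      Summable.of_nonneg_of_le (fun _ => norm_nonneg _) (fun k => bdz k _) sv
    have sconvz := (summable_norm_sum_mul_antidiagonal_of_summable_norm svz sgz).of_norm
    have cauchy := tsum_mul_tsum_eq_tsum_sum_antidiagonal_of_summable_norm svz sgz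
    have t : ∀ m, z ^ m • (C1 * (∑ kl ∈ Finset.HasAntidiagonal.antidiagonal m, fracKernel q μ kl.1 * g kl.2) -
        C2 * r m) = C1 * (∑ kl ∈ Finset.HasAntidiagonal.antidiagonal m, z ^ kl.1 * fracKernel q μ kl.1 *
          (z ^ kl.2 * g kl.2)) - C2 * (z ^ m * r m) := by
      intro m
      have : ∑ kl ∈ Finset.HasAntidiagonal.antidiagonal m, z ^ kl.1 * fracKernel q μ kl.1 *
          (z ^ kl.2 * g kl.2) =
          z ^ m * ∑ kl ∈ Finset.HasAntidiagonal.antidiagonal m, fracKernel q μ kl.1 * g kl.2 := by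
        rw [Finset.mul_sum]
        refine Finset.sum_congr rfl fun kl hkl => ?_
        rw [← Finset.HasAntidiagonal.mem_antidiagonal.1 hkl, pow_add]
        ring
      rw [this, smul_eq_mul]
      ring
    simp_rw [t]
    rw [(sconvz.mul_left C1).tsum_sub (srz.mul_left C2), tsum_mul_left, tsum_mul_left, ← cauchy]
    -- The same lower parameter D = q^{β+2} z balances both sums: b = q^{1-μ} z, c = q on the left,
    -- and b = qz, c = q^{μ+1} on the right.
    set D := q * q ^ β * q * z with hD
    have hD1 : D < 1 := hle (by positivity) (by nlinarith)
    have qz1 := hle hq0 hq1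
    have qmz1 := hle (by positivity) hqmμ
    have ev : ∑' k, z ^ k * fracKernel q μ k =
        qPochInf (q * q ^ (-μ) * z) q / qPochInf (q * z) q := by
      rw [show q * q ^ (-μ) * z = q ^ (-μ) * (q * z) by ring,
        ← qBinSeries_eq hq0 hq1 _ (by positivity) qz1]
      refine tsum_congr fun k => ?_
      rw [fracKernel, mul_pow]; ring
    have eAD : A * (q * q ^ (-μ) * z) = D := by
      rw [hA, eμβ, emμ, hD]; field_simp
    have egz := tsum_qBinCoeff_mul_sum (a := A) hq0 hq1 (by positivity) qmz1
      (by rwa [eAD]) d (n + 1)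
    rw [eAD, sum_jacobiCoeff_mul hq0 hq1 hq0 hq1 hD1 (by rw [← eAD]; ring)] at egz
    have eBD : q * q ^ β * (q * z) = D := by rw [hD]; ring
    have erz := tsum_qBinCoeff_mul_sum (a := q * q ^ β) hq0 hq1 (by positivity) qz1
      (by rwa [eBD]) c (n + 1)
    rw [eBD, sum_jacobiCoeff_mul hq0 hq1 (by positivity) hqμ hD1
      (by rw [← eBD, hA, eμβ]; ring)] at erz
    have eg' : ∑' k, z ^ k * g k = ∑' k, qBinCoeff A q k * (q * q ^ (-μ) * z) ^ k *
        ∑ i ∈ Finset.range (n + 1), d i * (q ^ k) ^ i := by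
      refine tsum_congr fun k => ?_
      simp only [hg]
      rw [mul_pow _ z]; ring
    have er' : ∑' k, z ^ k * r k = ∑' k, qBinCoeff (q * q ^ β) q k * (q * z) ^ k *
        ∑ i ∈ Finset.range (n + 1), c i * (q ^ k) ^ i := by
      refine tsum_congr fun k => ?_
      simp only [hr]
      rw [mul_pow _ z]; ring
    -- Pulling q^{-μ} out of each factor produces the q^{-nμ} of the eigenvalue.
    have eprod : ∏ i ∈ Finset.range n, (q * q ^ (-μ) * z - q * q ^ i) =
        (q ^ (-μ)) ^ n * ∏ i ∈ Finset.range n, (q * z - q * q ^ μ * q ^ i) := by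
      rw [← Finset.card_range n, ← Finset.prod_const, Finset.card_range,
        ← Finset.prod_mul_distrib]
      refine Finset.prod_congr rfl fun i _ => ?_
      rw [emμ]; field_simp
    have eAq : A * q / q = A := by field_simp
    have eAqμ : A * q / (q * q ^ μ) = q * q ^ β := by
      rw [hA, eμβ]; field_simp
    rw [ev, eg', er', egz, erz, eprod, eAq, eAqμ, hC1, hC2, eigval_eq hq0 hq1 hμ0 hβ, ← hA, ← hκ]
    have p1 := qPochFin_pos hq0 hq1 hq1 n
    have p2 := qPochFin_pos hq0 hq1 hqβ n
    have p3 := qPochFin_pos hq0 hq1 hqμ n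
    have p4 := qPochFin_pos hq0 hq1 hD1 n
    have p5 : 0 < qPoch q q β := by simpa using qPoch_pos hq0 hq1 hβ 0
    have p6 := qPochInf_pos hq0 hq1 qz1
    have p7 := qPochInf_pos hq0 hq1 qmz1
    generalize ∏ i ∈ Finset.range n, (q * z - q * q ^ μ * q ^ i) = P
    generalize qPochInf (q * q ^ (-μ) * z) q = X1 at *
    generalize (q ^ (-μ)) ^ n = X2
    field_simp
    ring

/-! ### Symmetry of the lattice operator. -/

/-- Summing a causal convolution against a sequence transposes it. -/
lemma tsum_mul_sum_range_eq {v H φ : ℕ → ℂ} {h : ℕ → ℝ} (hv : Summable fun j => ‖v j‖)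
    (hh : Summable h) (hb : ∀ j k, ‖H k‖ * ‖φ (k + j)‖ ≤ h k) :
    ∑' m, φ m * ∑ k ∈ Finset.range (m + 1), v (m - k) * H k =
      ∑' k, H k * ∑' j, v j * φ (k + j) := by
  have h0 : ∀ k, 0 ≤ h k := fun k => le_trans (by positivity) (hb 0 k)
  set F : ℕ × ℕ → ℂ := fun p => H p.1 * (v p.2 * φ (p.1 + p.2)) with hF
  have hs : Summable F := by
    refine Summable.of_norm_bounded (hh.mul_of_nonneg hv h0 fun _ => norm_nonneg _) fun p => ?_
    rw [hF, norm_mul, norm_mul]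
    calc ‖H p.1‖ * (‖v p.2‖ * ‖φ (p.1 + p.2)‖) = ‖H p.1‖ * ‖φ (p.1 + p.2)‖ * ‖v p.2‖ := by ring
      _ ≤ h p.1 * ‖v p.2‖ := mul_le_mul_of_nonneg_right (hb _ _) (norm_nonneg _)
  have hs' := Finset.HasAntidiagonal.sigmaAntidiagonalEquivProd.summable_iff.2 hs
  calc ∑' m, φ m * ∑ k ∈ Finset.range (m + 1), v (m - k) * H k
      = ∑' m, ∑ kl ∈ Finset.HasAntidiagonal.antidiagonal m, F kl := by
        refine tsum_congr fun m => ?_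
        rw [Finset.Nat.sum_antidiagonal_eq_sum_range_succ_mk, Finset.mul_sum]
        refine Finset.sum_congr rfl fun k hk => ?_
        have hk' : k ≤ m := Nat.lt_succ_iff.1 (Finset.mem_range.1 hk)
        simp only [hF, Nat.add_sub_cancel' hk']
        ring
    _ = ∑' p, F p := by
        rw [← Finset.HasAntidiagonal.sigmaAntidiagonalEquivProd.tsum_eq F]
        refine Eq.trans ?_ (Summable.tsum_sigma' (fun m => (hasSum_fintype _).summable) hs').symm
        refine tsum_congr fun m => ?_
        rw [tsum_fintype, ← Finset.sum_coe_sort]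
        rfl
    _ = ∑' k, H k * ∑' j, v j * φ (k + j) := by
        rw [hs.tsum_prod]
        exact tsum_congr fun k => by simp only [hF, tsum_mul_left]

/-- The left-hand side of the lattice equation, up to the factor `(1 - q)^(-2μ)`. -/
noncomputable def latticeOp (q μ β : ℝ) (y : ℝ → ℂ) (m : ℕ) : ℂ :=
  ∑ k ∈ Finset.range (m + 1), (fracKernel q μ (m - k) : ℂ) *
    ((innerWeight q μ β k : ℂ) * latticeDeriv q μ y k)

lemma norm_latticeDeriv_le {q : ℝ} (hq0 : 0 < q) (hq1 : q < 1) (μ : ℝ) {y : ℝ → ℂ} {k : ℕ}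
    {B : ℝ} (hB : ∀ j, ‖y (q ^ (k + j))‖ ≤ B) :
    ‖latticeDeriv q μ y k‖ ≤ (∑' j, ‖fracKernel q μ j‖) * B := by
  have hs := summable_fracKernel hq0 hq1 μ
  refine tsum_of_norm_bounded (hs.hasSum.mul_right B) fun j => ?_
  rw [norm_mul, Complex.norm_real]
  exact mul_le_mul_of_nonneg_left (hB j) (norm_nonneg _)

lemma rpow_mem_Ioo {q μ : ℝ} (hq0 : 0 < q) (hq1 : q < 1) (hμ0 : 0 < μ) :
    0 < q ^ μ ∧ q ^ μ < 1 :=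
  ⟨Real.rpow_pos_of_pos hq0 _, rpow_lt_one_of_pos hq0 hq1 hμ0⟩

/-- The weight alone behaves like q^{(1-2μ)k} and need not be summable. The decay q^{μk} of φ_n
supplies what is missing, so in the symmetry relation y has only to be bounded. -/
lemma summable_innerWeight {q μ β : ℝ} (hq0 : 0 < q) (hq1 : q < 1) (hμ0 : 0 < μ) (hμ1 : μ < 1)
    (hβ : -1 < β) : Summable fun k => ‖innerWeight q μ β k‖ * (q ^ μ) ^ k := by
  have hp := (rpow_mem_Ioo hq0 hq1 hμ0).1
  have hp' : 0 < q ^ (-μ) := Real.rpow_pos_of_pos hq0 _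
  refine ((summable_qBinCoeff hq0 hq1 (q * q ^ (μ + β)) (by positivity)
    (mul_rpow_lt_one hq0 hq1 (ν := -μ) (by linarith))).mul_left ‖qPoch q q (μ + β)‖).congr
    fun k => ?_
  rw [← norm_mul, ← innerWeight_eq hq0 hq1 (by linarith), norm_mul, norm_pow,
    Real.norm_of_nonneg hp.le]

/-- The lattice operator is symmetric. -/
lemma latticeOp_symm {q μ β : ℝ} (hq0 : 0 < q) (hq1 : q < 1) (hμ0 : 0 < μ) (hμ1 : μ < 1)
    (hβ : -1 < β) {y φ : ℝ → ℂ} {B C : ℝ} (hy : ∀ m : ℕ, ‖y (q ^ m)‖ ≤ B)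
    (hφ : ∀ m : ℕ, ‖φ (q ^ m)‖ ≤ C * (q ^ μ) ^ m) :
    ∑' m, φ (q ^ m) * latticeOp q μ β y m = ∑' m, y (q ^ m) * latticeOp q μ β φ m := by
  obtain ⟨hp, hp1⟩ := rpow_mem_Ioo hq0 hq1 hμ0
  have hB : 0 ≤ B := (norm_nonneg _).trans (hy 0)
  have hC : 0 ≤ C := by simpa using (norm_nonneg _).trans (hφ 0)
  have hv : Summable fun j => ‖(fracKernel q μ j : ℂ)‖ := by
    simpa only [Complex.norm_real] using summable_fracKernel hq0 hq1 μ
  set S := ∑' j, ‖fracKernel q μ j‖ with hS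
  have hS0 : 0 ≤ S := tsum_nonneg fun _ => norm_nonneg _
  have hh := (summable_innerWeight hq0 hq1 hμ0 hμ1 hβ).mul_left (S * B * C)
  have hφ' : ∀ k j : ℕ, ‖φ (q ^ (k + j))‖ ≤ C * (q ^ μ) ^ k := fun k j => by
    refine (hφ _).trans (mul_le_mul_of_nonneg_left ?_ hC)
    exact pow_le_pow_of_le_one hp.le hp1.le (Nat.le_add_right k j)
  have e1 := tsum_mul_sum_range_eq (φ := fun m => φ (q ^ m))
    (H := fun k => (innerWeight q μ β k : ℂ) * latticeDeriv q μ y k) hv hh (fun j k => by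
      rw [norm_mul, Complex.norm_real]
      calc _ ≤ ‖innerWeight q μ β k‖ * (S * B) * (C * (q ^ μ) ^ k) := by
            gcongr
            · exact norm_latticeDeriv_le hq0 hq1 μ fun j => hy _
            · exact hφ' k j
        _ = _ := by ring)
  have e2 := tsum_mul_sum_range_eq (φ := fun m => y (q ^ m))
    (H := fun k => (innerWeight q μ β k : ℂ) * latticeDeriv q μ φ k) hv hh (fun j k => by
      rw [norm_mul, Complex.norm_real]
      calc _ ≤ ‖innerWeight q μ β k‖ * (S * (C * (q ^ μ) ^ k)) * B := by
            gcongr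
            · exact norm_latticeDeriv_le hq0 hq1 μ (hφ' k)
            · exact hy _
        _ = _ := by ring)
  simp only [latticeOp]
  rw [e1, e2]
  refine tsum_congr fun k => ?_
  change _ * latticeDeriv q μ φ k = _ * latticeDeriv q μ y k
  ring

/-! ### Regularity and completeness of the φ_n. -/

/-- The pairing of `y` with `φ_n` on the lattice. -/
noncomputable def pairing (q μ β : ℝ) (y : ℝ → ℂ) (n : ℕ) : ℂ :=
  ∑' m : ℕ, (outerWeight q μ β m : ℂ) * y (q ^ m) * (phi q μ β n (q ^ m) : ℂ)

lemma exists_jacobi_bound {q : ℝ} (hq0 : 0 < q) (hq1 : q < 1) (μ β : ℝ) (n : ℕ) :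
    ∃ C : ℝ, 0 ≤ C ∧ ∀ m : ℕ, |phi q μ β n (q ^ m)| ≤ C * (q ^ μ) ^ m := by
  have hp : 0 < q ^ μ := Real.rpow_pos_of_pos hq0 _
  refine ⟨∑ i ∈ Finset.range (n + 1), |jacobiCoeff q (q * q ^ (μ + β)) (q * q ^ μ) n i|,
    Finset.sum_nonneg fun _ _ => abs_nonneg _, fun m => ?_⟩
  rw [phi_pow hq0, abs_mul, abs_of_pos (pow_pos hp m), mul_comm]
  refine mul_le_mul_of_nonneg_right ((Finset.abs_sum_le_sum_abs _ _).trans ?_) (by positivity)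
  refine Finset.sum_le_sum fun i _ => ?_
  rw [abs_mul]
  refine mul_le_of_le_one_right (abs_nonneg _) ?_
  rw [abs_of_pos (by positivity)]
  exact pow_le_one₀ (by positivity) (pow_le_one₀ hq0.le hq1.le)

lemma phi_zero {q μ : ℝ} (hμ0 : 0 < μ) (β : ℝ) (n : ℕ) : phi q μ β n 0 = 0 := by
  rw [phi, Real.zero_rpow hμ0.ne', zero_mul]

lemma qAbsCont_phi {q μ : ℝ} (hq0 : 0 < q) (hq1 : q < 1) (hμ0 : 0 < μ) (β : ℝ) (n : ℕ) :
    QAbsCont q fun x => (phi q μ β n x : ℂ) := by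
  obtain ⟨hp, hp1⟩ := rpow_mem_Ioo hq0 hq1 hμ0
  obtain ⟨C, hC, hb⟩ := exists_jacobi_bound hq0 hq1 μ β n
  have hgeo := summable_geometric_of_lt_one hp.le hp1
  have hb' : ∀ m j : ℕ, ‖(phi q μ β n (q ^ m * q ^ j) : ℂ)‖ ≤ C * (q ^ μ) ^ j := fun m j => by
    rw [Complex.norm_real, ← pow_add]
    refine (hb _).trans (mul_le_mul_of_nonneg_left ?_ hC)
    exact pow_le_pow_of_le_one hp.le hp1.le (Nat.le_add_left j m)
  refine ⟨fun x hx => ?_, ∑' j : ℕ, 2 * C * (q ^ μ) ^ j, fun u hu => ?_⟩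
  · simp only [phi_zero hμ0, Complex.ofReal_zero]
    rcases hx with ⟨m, rfl⟩ | hx
    · have := (tendsto_pow_atTop_nhds_zero_of_lt_one hp.le hp1).const_mul C
      rw [mul_zero] at this
      exact squeeze_zero_norm (hb' m) this
    · rw [Set.mem_singleton_iff.1 hx]
      simp [phi_zero hμ0]
  · rcases hu with ⟨m, rfl⟩ | hu
    · have bd : ∀ j : ℕ, ‖(phi q μ β n (q ^ m * q ^ j) : ℂ) - phi q μ β n (q ^ m * q ^ (j + 1))‖
          ≤ 2 * C * (q ^ μ) ^ j := fun j => by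
        have h2 := hb' m (j + 1)
        have h3 : C * (q ^ μ) ^ (j + 1) ≤ C * (q ^ μ) ^ j :=
          mul_le_mul_of_nonneg_left (pow_le_pow_of_le_one hp.le hp1.le j.le_succ) hC
        linarith [norm_sub_le (phi q μ β n (q ^ m * q ^ j) : ℂ) (phi q μ β n (q ^ m * q ^ (j + 1))),
          hb' m j]
      have hs := Summable.of_nonneg_of_le (fun _ => norm_nonneg _) bd (hgeo.mul_left (2 * C))
      exact ⟨hs, hs.tsum_le_tsum bd (hgeo.mul_left (2 * C))⟩
    · rw [Set.mem_singleton_iff.1 hu]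
      simp only [zero_mul, sub_self, norm_zero, tsum_zero]
      exact ⟨summable_zero, tsum_nonneg fun _ => by positivity⟩

lemma exists_phi_ne_zero {q : ℝ} (hq0 : 0 < q) (hq1 : q < 1) (μ β : ℝ) (n : ℕ) :
    ∃ m : ℕ, phi q μ β n (q ^ m) ≠ 0 := by
  by_contra! h
  have hp : 0 < q ^ μ := Real.rpow_pos_of_pos hq0 _
  have hz : ∀ m : ℕ, ∑ i ∈ Finset.range (n + 1),
      jacobiCoeff q (q * q ^ (μ + β)) (q * q ^ μ) n i * (q ^ m) ^ i = 0 := fun m => by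
    have := h m
    rw [phi_pow hq0] at this
    exact (mul_eq_zero.1 this).resolve_left (by positivity)
  -- As m → ∞ the polynomial factor tends to its constant coefficient, which is 1.
  have lim := tendsto_finsetSum (Finset.range (n + 1)) fun i _ =>
    ((tendsto_pow_atTop_nhds_zero_of_lt_one hq0.le hq1).pow i).const_mul
      (jacobiCoeff q (q * q ^ (μ + β)) (q * q ^ μ) n i)
  simp_rw [hz] at lim
  have := tendsto_nhds_unique lim tendsto_const_nhds
  rw [Finset.sum_range_succ'] at this
  simp [jacobiCoeff, qPochFin_zero] at this

/-- Says that p_n has exact degree n, so the passage from moments to pairings is triangular and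
invertible. -/
lemma jacobiCoeff_self_ne_zero {q A c : ℝ} (hq0 : 0 < q) (hq1 : q < 1) (hA : A < 1) (hc : c < 1)
    (n : ℕ) : jacobiCoeff q A c n n ≠ 0 := by
  have p1 := qPochFin_pos hq0 hq1 hq1 n
  have p2 := qPochFin_pos hq0 hq1 hc n
  have p3 := qPochFin_pos hq0 hq1 (mul_pow_lt_one hq0 hq1 hA n) n
  have p4 : qPochFin (q ^ n)⁻¹ q n ≠ 0 := by
    refine Finset.prod_ne_zero_iff.2 fun i hi => ?_
    have hi' : i < n := Finset.mem_range.1 hi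
    have : q ^ n < q ^ i := pow_lt_pow_right_of_lt_one₀ hq0 hq1 hi'
    have hn : 0 < q ^ n := pow_pos hq0 n
    rw [sub_ne_zero, ne_comm, inv_mul_eq_div, Ne, div_eq_one_iff_eq hn.ne']
    exact this.ne'
  rw [jacobiCoeff]
  positivity

/-- The sequence of weighted values whose moments are given by the pairings. -/
noncomputable def weightedValues (q β : ℝ) (y : ℝ → ℂ) (m : ℕ) : ℂ :=
  ((qPoch q q β * (qBinCoeff (q * q ^ β) q m * q ^ m) : ℝ) : ℂ) * y (q ^ m)

lemma summable_weightedValues {q : ℝ} (hq0 : 0 < q) (hq1 : q < 1) (β : ℝ) {y : ℝ → ℂ} {B : ℝ}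
    (hy : ∀ m : ℕ, ‖y (q ^ m)‖ ≤ B) : Summable fun m => ‖weightedValues q β y m‖ := by
  refine Summable.of_nonneg_of_le (fun _ => norm_nonneg _) (fun m => ?_)
    (((summable_qBinCoeff hq0 hq1 (q * q ^ β) hq0.le hq1).mul_left ‖qPoch q q β‖).mul_right B)
  rw [weightedValues, norm_mul, Complex.norm_real, norm_mul]
  exact mul_le_mul_of_nonneg_left (hy m) (by positivity)

/-- The x^μ of φ_n cancels the x^{-μ} in the weight, leaving integer powers of q^m: the pairing with
φ_n is a combination of the moments of order 0, …, n. -/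
lemma pairing_term {q μ β : ℝ} (hq0 : 0 < q) (hq1 : q < 1) (hβ : -1 < β) (y : ℝ → ℂ)
    (n m : ℕ) :
    (outerWeight q μ β m : ℂ) * y (q ^ m) * (phi q μ β n (q ^ m) : ℂ) =
      ∑ i ∈ Finset.range (n + 1), (jacobiCoeff q (q * q ^ (μ + β)) (q * q ^ μ) n i : ℂ) *
        ((q ^ i) ^ m • weightedValues q β y m) := by
  have e := congrArg (fun x : ℝ => (x : ℂ)) (outerWeight_eq (μ := μ) hq0 hq1 hβ m)
  simp only [Complex.ofReal_mul] at e
  rw [phi_pow hq0]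
  push_cast
  have : ∀ i ∈ Finset.range (n + 1), (jacobiCoeff q (q * q ^ (μ + β)) (q * q ^ μ) n i : ℂ) *
        ((q ^ i) ^ m • weightedValues q β y m) = weightedValues q β y m *
      ((jacobiCoeff q (q * q ^ (μ + β)) (q * q ^ μ) n i : ℂ) * ((q : ℂ) ^ m) ^ i) := fun i _ => by
    rw [Complex.real_smul]; push_cast; ring
  rw [Finset.sum_congr rfl this, ← Finset.mul_sum, weightedValues]
  push_cast at e ⊢
  rw [← e]
  ring

lemma summable_pow_smul_weightedValues {q : ℝ} (hq0 : 0 < q) (hq1 : q < 1) (β : ℝ)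
    {y : ℝ → ℂ} {B : ℝ} (hy : ∀ m : ℕ, ‖y (q ^ m)‖ ≤ B) (i : ℕ) :
    Summable fun m : ℕ => (q ^ i) ^ m • weightedValues q β y m := by
  refine Summable.of_norm_bounded (summable_weightedValues hq0 hq1 β hy) fun m => ?_
  rw [norm_smul, Real.norm_of_nonneg (by positivity)]
  exact mul_le_of_le_one_left (norm_nonneg _)
    (pow_le_one₀ (by positivity) (pow_le_one₀ hq0.le hq1.le))

lemma summable_pairing {q μ β : ℝ} (hq0 : 0 < q) (hq1 : q < 1) (hβ : -1 < β)
    {y : ℝ → ℂ} {B : ℝ} (hy : ∀ m : ℕ, ‖y (q ^ m)‖ ≤ B) (n : ℕ) :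
    Summable fun m : ℕ => (outerWeight q μ β m : ℂ) * y (q ^ m) * (phi q μ β n (q ^ m) : ℂ) := by
  simp_rw [pairing_term hq0 hq1 hβ]
  exact summable_sum fun i _ => (summable_pow_smul_weightedValues hq0 hq1 β hy i).mul_left _

/-- Completeness: a bounded function orthogonal to every `φ_n` vanishes on the lattice. -/
theorem eq_zero_of_pairing_eq_zero {q μ β : ℝ} (hq0 : 0 < q) (hq1 : q < 1) (hμ0 : 0 < μ)
    (hβ : -1 < β) {y : ℝ → ℂ} {B : ℝ} (hy : ∀ m : ℕ, ‖y (q ^ m)‖ ≤ B)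
    (h : ∀ n, pairing q μ β y n = 0) (m : ℕ) : y (q ^ m) = 0 := by
  have hs := summable_pow_smul_weightedValues hq0 hq1 β hy
  have moments : ∀ n : ℕ, ∑' m : ℕ, (q ^ n) ^ m • weightedValues q β y m = 0 := by
    intro n
    induction n using Nat.strong_induction_on with
    | _ n ih =>
      have hn := h n
      simp_rw [pairing, pairing_term hq0 hq1 hβ] at hn
      rw [Summable.tsum_finsetSum fun i _ => (hs i).mul_left _] at hn
      simp_rw [tsum_mul_left] at hn
      rw [Finset.sum_range_succ, Finset.sum_eq_zero fun i hi => by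
        rw [ih i (Finset.mem_range.1 hi), mul_zero], zero_add] at hn
      refine (mul_eq_zero.1 hn).resolve_left (Complex.ofReal_ne_zero.2 ?_)
      exact jacobiCoeff_self_ne_zero hq0 hq1 (mul_rpow_lt_one hq0 hq1 (by linarith))
        (mul_rpow_lt_one hq0 hq1 (by linarith)) n
  -- The n-th moment is the value at q^n of the power series whose coefficients are the weighted
  -- values.
  have := eq_zero_of_tsum_pow_smul_eq_zero hq0 hq1 (summable_weightedValues hq0 hq1 β hy) moments m
  refine (mul_eq_zero.1 this).resolve_left (Complex.ofReal_ne_zero.2 ?_)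
  have p := qPoch_pos hq0 hq1 hβ m
  rw [qPoch_pow_succ hq0 hq1 hβ] at p
  rw [← mul_assoc]
  exact (mul_pos p (pow_pos hq0 m)).ne'

/-! ### Simplicity and exhaustion of the spectrum. -/

lemma eigval_pos {q μ β : ℝ} (hq0 : 0 < q) (hq1 : q < 1) (hμ0 : 0 < μ) (hβ : -1 < β) (n : ℕ) :
    0 < eigval q μ β n := by
  have hq : 0 < 1 - q := by linarith
  have hP : ∀ {s : ℝ}, -1 < s → 0 < qPoch q q s := fun hs => by
    simpa using qPoch_pos hq0 hq1 hs 0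
  have hF : ∀ {s : ℝ}, -1 < s → 0 < qPochFin (q * q ^ s) q n := fun hs =>
    qPochFin_pos hq0 hq1 (mul_rpow_lt_one hq0 hq1 hs) n
  have a1 := hP hβ
  have a2 := hP (s := μ) (by linarith)
  have a3 := hP (s := μ + β) (by linarith)
  have b1 := hF hβ
  have b2 := hF (s := μ) (by linarith)
  have b3 := hF (s := μ + β) (by linarith)
  have c1 := qPochFin_pos hq0 hq1 hq1 n
  have d1 : 0 < (1 - q) ^ (-(2 * μ)) := Real.rpow_pos_of_pos hq _
  have d2 : 0 < q ^ (-μ) := Real.rpow_pos_of_pos hq0 _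
  rw [eigval_eq hq0 hq1 hμ0 hβ]
  positivity

/-- The ratio λ_{n+1}/λ_n is q^{-μ} > 1 times two quotients that are at least 1, because q^μ < 1. -/
lemma eigval_strictMono {q μ β : ℝ} (hq0 : 0 < q) (hq1 : q < 1) (hμ0 : 0 < μ) (hβ : -1 < β) :
    StrictMono (eigval q μ β) := by
  refine strictMono_nat_of_lt_succ fun n => ?_
  have hn := pow_pos hq0 n
  obtain ⟨hp, hp1⟩ := rpow_mem_Ioo hq0 hq1 hμ0
  have pβ : 0 < q ^ β := Real.rpow_pos_of_pos hq0 _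
  have hqβ := mul_rpow_lt_one hq0 hq1 hβ
  have t1 : 0 < 1 - q * q ^ β * q ^ n := by linarith [mul_pow_lt_one hq0 hq1 hqβ n]
  have t2 : 0 < 1 - q * q ^ n := by linarith [mul_pow_lt_one hq0 hq1 hq1 n]
  have eμβ : q ^ (μ + β) = q ^ μ * q ^ β := Real.rpow_add hq0 _ _
  have step : eigval q μ β (n + 1) = eigval q μ β n * (q ^ (-μ) *
      ((1 - q * q ^ (μ + β) * q ^ n) * (1 - q * q ^ μ * q ^ n)) /
      ((1 - q * q ^ β * q ^ n) * (1 - q * q ^ n))) := by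
    rw [eigval_eq hq0 hq1 hμ0 hβ, eigval_eq hq0 hq1 hμ0 hβ, qPochFin_succ, qPochFin_succ,
      qPochFin_succ, qPochFin_succ, pow_succ]
    simp only [div_mul_div_comm]
    congr 1 <;> ring
  rw [step]
  refine lt_mul_of_one_lt_right (eigval_pos hq0 hq1 hμ0 hβ n) ?_
  rw [one_lt_div (mul_pos t1 t2)]
  have h1 : 1 - q * q ^ β * q ^ n ≤ 1 - q * q ^ (μ + β) * q ^ n := by
    rw [eμβ]
    have : 0 < q * q ^ β * q ^ n := by positivity
    nlinarith
  have h2 : 1 - q * q ^ n ≤ 1 - q * q ^ μ * q ^ n := by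
    have : 0 < q * q ^ n := by positivity
    nlinarith
  have h3 : 1 < q ^ (-μ) := by
    rw [Real.rpow_neg hq0.le]; exact (one_lt_inv₀ hp).2 hp1
  calc (1 - q * q ^ β * q ^ n) * (1 - q * q ^ n)
      ≤ (1 - q * q ^ (μ + β) * q ^ n) * (1 - q * q ^ μ * q ^ n) :=
        mul_le_mul h1 h2 t2.le (t1.le.trans h1)
    _ < _ := lt_mul_of_one_lt_left (mul_pos (t1.trans_le h1) (t2.trans_le h2)) h3

lemma isEigenfunction_phi {q μ β : ℝ} (hq0 : 0 < q) (hq1 : q < 1) (hμ0 : 0 < μ) (hμ1 : μ < 1)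
    (hβ : -1 < β) (n : ℕ) :
    IsEigenfunction q μ β (eigval q μ β n : ℂ) fun x => (phi q μ β n x : ℂ) := by
  have hac := qAbsCont_phi hq0 hq1 hμ0 β n
  have h0 : (phi q μ β n 0 : ℂ) = 0 := by rw [phi_zero hμ0, Complex.ofReal_zero]
  obtain ⟨m, hm⟩ := exists_phi_ne_zero hq0 hq1 μ β n
  refine ⟨hac, ⟨q ^ m, qSetStar_pow q m, Complex.ofReal_ne_zero.2 hm⟩, ?_, h0,
    rightInt_one_div hq0 _⟩
  rw [solvesEquation_iff hq0 hq1 hμ1 _ hac h0]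
  intro m
  have := congrArg (fun x : ℝ => (x : ℂ)) (lattice_equation_phi hq0 hq1 hμ0 hμ1 hβ n m)
  simp only [Complex.ofReal_mul, Complex.ofReal_sum, Complex.ofReal_tsum] at this
  exact this

lemma IsEigenfunction.exists_bound {q μ β : ℝ} {lam : ℂ} {y : ℝ → ℂ}
    (hy : IsEigenfunction q μ β lam y) : ∃ B : ℝ, ∀ m : ℕ, ‖y (q ^ m)‖ ≤ B := by
  have h := hy.1.1 (q ^ 0) (qSetStar_pow q 0)
  simp only [pow_zero, one_mul] at h
  obtain ⟨B, hB⟩ := h.norm.bddAbove_range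
  exact ⟨B, fun m => hB ⟨m, rfl⟩⟩

/-- An eigenfunction is orthogonal to every `φ_n` belonging to another eigenvalue. -/
lemma IsEigenfunction.pairing_eq_zero {q μ β : ℝ} (hq0 : 0 < q) (hq1 : q < 1) (hμ0 : 0 < μ)
    (hμ1 : μ < 1) (hβ : -1 < β) {lam : ℂ} {y : ℝ → ℂ} (hy : IsEigenfunction q μ β lam y)
    {n : ℕ} (hn : lam ≠ (eigval q μ β n : ℂ)) : pairing q μ β y n = 0 := by
  obtain ⟨B, hB⟩ := hy.exists_bound
  obtain ⟨C, hC, hb⟩ := exists_jacobi_bound hq0 hq1 μ β n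
  have hφ := isEigenfunction_phi hq0 hq1 hμ0 hμ1 hβ n
  have e1 := (solvesEquation_iff hq0 hq1 hμ1 _ hy.1 hy.2.2.2.1).1 hy.2.2.1
  have e2 := (solvesEquation_iff hq0 hq1 hμ1 _ hφ.1 hφ.2.2.2.1).1 hφ.2.2.1
  have symm := congrArg (fun t => (((1 - q) ^ (-(2 * μ)) : ℝ) : ℂ) * t)
    (latticeOp_symm hq0 hq1 hμ0 hμ1 hβ (φ := fun x => (phi q μ β n x : ℂ)) hB
    (fun m => by rw [Complex.norm_real]; exact hb m))
  simp only [← tsum_mul_left] at symm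
  have l : ∀ m, (((1 - q) ^ (-(2 * μ)) : ℝ) : ℂ) *
      ((phi q μ β n (q ^ m) : ℂ) * latticeOp q μ β y m) = lam *
        ((outerWeight q μ β m : ℂ) * y (q ^ m) * (phi q μ β n (q ^ m) : ℂ)) := fun m => by
    rw [mul_left_comm, latticeOp, e1 m]; ring
  have r : ∀ m, (((1 - q) ^ (-(2 * μ)) : ℝ) : ℂ) *
      (y (q ^ m) * latticeOp q μ β (fun x => (phi q μ β n x : ℂ)) m) = (eigval q μ β n : ℂ) *
        ((outerWeight q μ β m : ℂ) * y (q ^ m) * (phi q μ β n (q ^ m) : ℂ)) := fun m => by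
    rw [mul_left_comm, latticeOp, e2 m]; ring
  simp_rw [l, r] at symm
  rw [tsum_mul_left, tsum_mul_left, ← sub_eq_zero, ← sub_mul] at symm
  exact (mul_eq_zero.1 symm).resolve_left (sub_ne_zero.2 hn)

lemma IsEigenfunction.exists_pow_ne_zero {q μ β : ℝ} {lam : ℂ} {y : ℝ → ℂ}
    (hy : IsEigenfunction q μ β lam y) : ∃ m : ℕ, y (q ^ m) ≠ 0 := by
  obtain ⟨x, ⟨m, rfl⟩ | hx, hne⟩ := hy.2.1
  · exact ⟨m, hne⟩
  · rw [Set.mem_singleton_iff.1 hx] at hne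
    exact absurd hy.2.2.2.1 hne

lemma IsEigenfunction.exists_eq_eigval {q μ β : ℝ} (hq0 : 0 < q) (hq1 : q < 1) (hμ0 : 0 < μ)
    (hμ1 : μ < 1) (hβ : -1 < β) {lam : ℂ} {y : ℝ → ℂ} (hy : IsEigenfunction q μ β lam y) :
    ∃ n : ℕ, lam = (eigval q μ β n : ℂ) := by
  by_contra! h
  obtain ⟨B, hB⟩ := hy.exists_bound
  obtain ⟨m, hm⟩ := hy.exists_pow_ne_zero
  exact hm (eq_zero_of_pairing_eq_zero hq0 hq1 hμ0 hβ hB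
    (fun n => hy.pairing_eq_zero hq0 hq1 hμ0 hμ1 hβ (h n)) m)

lemma IsEigenfunction.eq_const_mul_phi {q μ β : ℝ} (hq0 : 0 < q) (hq1 : q < 1) (hμ0 : 0 < μ)
    (hμ1 : μ < 1) (hβ : -1 < β) {n : ℕ} {y : ℝ → ℂ}
    (hy : IsEigenfunction q μ β (eigval q μ β n : ℂ) y) :
    ∃ c : ℂ, ∀ x ∈ qSetStar q, y x = c * (phi q μ β n x : ℂ) := by
  set φ : ℝ → ℂ := fun x => (phi q μ β n x : ℂ) with hφdef
  have hφ : IsEigenfunction q μ β (eigval q μ β n : ℂ) φ :=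
    isEigenfunction_phi hq0 hq1 hμ0 hμ1 hβ n
  obtain ⟨B, hB⟩ := hy.exists_bound
  obtain ⟨B', hB'⟩ := hφ.exists_bound
  have hinj : ∀ k, k ≠ n → (eigval q μ β n : ℂ) ≠ (eigval q μ β k : ℂ) := fun k hk h =>
    hk ((eigval_strictMono hq0 hq1 hμ0 hβ).injective (Complex.ofReal_injective h)).symm
  -- By completeness: φ_n is orthogonal to every other φ_k, so it would vanish if it were also
  -- orthogonal to itself.
  have hN : pairing q μ β φ n ≠ 0 := fun h0 => by
    obtain ⟨m, hm⟩ := hφ.exists_pow_ne_zero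
    refine hm (eq_zero_of_pairing_eq_zero hq0 hq1 hμ0 hβ hB' (fun k => ?_) m)
    by_cases hk : k = n
    · rw [hk, h0]
    · exact hφ.pairing_eq_zero hq0 hq1 hμ0 hμ1 hβ (hinj k hk)
  -- The projection coefficient: y - cφ_n is bounded and orthogonal to every φ_k, hence zero on the
  -- lattice.
  set c := pairing q μ β y n / pairing q μ β φ n with hc
  have hz : ∀ m : ℕ, ‖y (q ^ m) - c * φ (q ^ m)‖ ≤ B + ‖c‖ * B' := fun m => by
    refine (norm_sub_le _ _).trans (add_le_add (hB m) ?_)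
    rw [norm_mul]
    exact mul_le_mul_of_nonneg_left (hB' m) (norm_nonneg _)
  have lin : ∀ k, pairing q μ β (fun x => y x - c * φ x) k =
      pairing q μ β y k - c * pairing q μ β φ k := fun k => by
    rw [pairing, pairing, pairing, ← tsum_mul_left,
      ← (summable_pairing hq0 hq1 hβ hB k).tsum_sub
        ((summable_pairing hq0 hq1 hβ hB' k).mul_left c)]
    refine tsum_congr fun m => ?_
    ring
  have vanish := eq_zero_of_pairing_eq_zero hq0 hq1 hμ0 hβ hz fun k => by
    rw [lin]
    by_cases hk : k = n
    · rw [hk, hc, div_mul_cancel₀ _ hN, sub_self]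
    · rw [hy.pairing_eq_zero hq0 hq1 hμ0 hμ1 hβ (hinj k hk),
        hφ.pairing_eq_zero hq0 hq1 hμ0 hμ1 hβ (hinj k hk), mul_zero, sub_zero]
  refine ⟨c, fun x hx => ?_⟩
  rcases hx with ⟨m, rfl⟩ | hx
  · exact sub_eq_zero.1 (vanish m)
  · rw [Set.mem_singleton_iff.1 hx, hy.2.2.2.1, phi_zero hμ0, Complex.ofReal_zero, mul_zero]

end QFrac

theorem theorem5p5 (q : ℝ) (hq0 : 0 < q) (hq1 : q < 1) (μ : ℝ) (hμ0 : 0 < μ) (hμ1 : μ < 1)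
    (β : ℝ) (hβ : -1 < β) :
    (∀ n : ℕ, QFrac.IsEigenfunction q μ β ((QFrac.eigval q μ β n : ℝ) : ℂ)
      (fun x => ((QFrac.phi q μ β n x : ℝ) : ℂ))) ∧
    (∀ (lam : ℂ) (y : ℝ → ℂ), QFrac.IsEigenfunction q μ β lam y →
      ∃ n : ℕ, lam = ((QFrac.eigval q μ β n : ℝ) : ℂ)) ∧
    (∀ (n : ℕ) (y : ℝ → ℂ),
      QFrac.IsEigenfunction q μ β ((QFrac.eigval q μ β n : ℝ) : ℂ) y →
      ∃ c : ℂ, ∀ x ∈ QFrac.qSetStar q, y x = c * ((QFrac.phi q μ β n x : ℝ) : ℂ)) :=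
  ⟨QFrac.isEigenfunction_phi hq0 hq1 hμ0 hμ1 hβ,
    fun _ _ hy => hy.exists_eq_eigval hq0 hq1 hμ0 hμ1 hβ,
    fun _ _ hy => hy.eq_const_mul_phi hq0 hq1 hμ0 hμ1 hβ⟩
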